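/- Let $k\ge 1$ and $N\ge 2$ be integers and let $F(n)=\prod_{j=1}^k (a_jn+b_j)$, where $a_j,b_j\in\mathbb{Z}$, $a_j\neq 0$ and $|a_j|,|b_j|\le N$ for all $j$. Suppose that the discriminant $\prod_{1\le i<j\le k}(a_ib_j-a_jb_i)$ is non-zero. For $q\ge 1$ let $\gamma(q):=q^{-1}\,|\{n\in\mathbb{Z}/q\mathbb{Z} : \gcd(q,F(n))=1\}|$, and suppose that $F$ is non-degenerate, that is, $\gamma(q)>0$ for all $q\ge 1$. Let $X(F)$ be the set of positive integers $n$ such that $F(n)$ is the product of $k$ primes (not necessarily distinct), and put $$h(\theta):=\sum_{n\le N,\ n\in X(F)}e^{2\pi i n\theta},\qquad \mathfrak{S}_F:=\prod_{\ell\text{ prime}}\frac{\gamma(\ell)}{(1-1/\ell)^k}.$$ Then the infinite product $\mathfrak{S}_F$ converges unconditionally, and for every real $2<p<\infty$ $$\Big(\int_0^1|h(\theta)|^p\,d\theta\Big)^{1/p}\le C(p,k)\,\mathfrak{S}_F\,N^{1-1/p}(\log N)^{-k},$$ where the constant $C(p,k)$ depends only on $p$ and $k$, and is explicitly computable: $C(p,k)$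 can be taken to be a natural number such that $(r,s,k)\mapsto C(r/s,k)$ is a computable function of the natural numbers $r,s,k$ with $r/s>2$. -/

import Mathlib

namespace PrimeTuples

/-- The value at the integer `n` of `F = ∏ⱼ (aⱼ n + bⱼ)`, a product of `k` integer linear forms. -/
def formProd {k : ℕ} (a b : Fin k → ℤ) (n : ℤ) : ℤ :=
  ∏ j, (a j * n + b j)

/-- The discriminant `∏_{i < j} (aᵢ bⱼ - aⱼ bᵢ)`. -/
def discriminant {k : ℕ} (a b : Fin k → ℤ) : ℤ :=
  ∏ i, ∏ j ∈ Finset.Ioi i, (a i * b j - a j * b i)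

/-- `m` is the product of `k` (positive, not necessarily distinct) primes. -/
def IsProductOfPrimes (k : ℕ) (m : ℤ) : Prop :=
  ∃ q : Fin k → ℕ, (∀ i, (q i).Prime) ∧ m = ∏ i, (q i : ℤ)

/-- `X(F)`: the positive integers `n` such that `F(n)` is the product of `k` primes. -/
def X {k : ℕ} (a b : Fin k → ℤ) : Set ℕ :=
  {n | 1 ≤ n ∧ IsProductOfPrimes k (formProd a b n)}

/-- `γ(q)`: the proportion of residues `n` modulo `q` with `(q, F(n)) = 1`; the residue classes are
represented by `0, …, q - 1`. -/
noncomputable def gamma {k : ℕ} (a b : Fin k → ℤ) (q : ℕ) : ℝ :=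
  (((Finset.range q).filter fun n : ℕ => Int.gcd (q : ℤ) (formProd a b n) = 1).card : ℝ) / q

/-- The non-degeneracy condition: `γ(q) > 0` for all `q ≥ 1`. -/
def NonDegenerate {k : ℕ} (a b : Fin k → ℤ) : Prop :=
  ∀ q : ℕ, 1 ≤ q → 0 < gamma a b q

/-- The factor `γ(p) / (1 - 1/p)^k` of the singular series at the prime `p`. -/
noncomputable def localFactor {k : ℕ} (a b : Fin k → ℤ) (p : Nat.Primes) : ℝ :=
  gamma a b (p : ℕ) / (1 - 1 / ((p : ℕ) : ℝ)) ^ k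

/-- The singular series `𝔖_F = ∏_p γ(p) / (1 - 1/p)^k`. -/
noncomputable def singularSeries {k : ℕ} (a b : Fin k → ℤ) : ℝ :=
  ∏' p : Nat.Primes, localFactor a b p

open Classical in
/-- The exponential sum `h(θ) = ∑_{n ≤ N, n ∈ X(F)} e(nθ)`, where `e(x) = exp(2πix)`. -/
noncomputable def expSum {k : ℕ} (a b : Fin k → ℤ) (N : ℕ) (θ : ℝ) : ℂ :=
  ∑ n ∈ (Finset.Icc 1 N).filter (fun n => n ∈ X a b),
    Complex.exp (2 * Real.pi * Complex.I * ((n : ℝ) * θ : ℝ))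

/-- The norm `(∫₀¹ |h(θ)|^p dθ)^(1/p)` of a 1-periodic function `h`. -/
noncomputable def circleLpNorm (h : ℝ → ℂ) (p : ℝ) : ℝ :=
  (∫ θ in (0 : ℝ)..1, ‖h θ‖ ^ p) ^ (1 / p)

end PrimeTuples

namespace PrimeTuples

open Finset MeasureTheory intervalIntegral

/-! Put `M = 𝔖_F N / (log N)^k`. The core is a discrete restriction estimate: if `θ_1, …, θ_r` are
`1/N`-separated, then `∑ |h(θ_i)|²` is at most a constant times `M² r^ε`, with `ε` as small as
desired. Ordering the values decreasingly gives `|h(θ_i)| ≪ M i^(-(1-ε)/2)`, so `∑ |h(θ_i)|^p ≪ M^p`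
as soon as `(1-ε)p/2 > 1`, which is possible because `p > 2`. Averaging this over the translates of
the grid `j/N` gives the integral.

For the discrete estimate, replace `X(F)` by the set `s` on which `F` has no prime factor up to a
small power `z` of `N`; the exceptions are few, because one of the forms must be small there. The
set `s` avoids residue classes modulo each prime up to `z`, so Montgomery's inequality
(`montgomery`) bounds `|h(θ)|²` times a sieve weight by the sum of `|h(θ + x)|²` over Farey
fractions `x`. Applying the large sieve to all points `θ_i + x` at once needs these to be separated.
For one pair `(i, j)` all near-coincidences share the same difference `x - y`, a non-integer, so a
single prime accounts for them (`exists_prime_dvd_of_close`). Discarding at most `r²` primes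
restores the separation, and the inequality becomes `∑ |h(θ_i)|² ≪ N |s| ∏ γ(p)` over the remaining
primes.

Rankin's trick (`half_prod_inv_le`) justifies the full product in place of the truncated sieve sum.
That product is `O(𝔖_F (log N)^(-k))`, and the discarded primes cost only `r^ε`
(`prod_inv_le_of_card`). The case of the single point `0` bounds `|s|` by `O(M)`. Uniformity in the
coefficients comes from a lower bound, depending only on `k`, for all finite products of local
factors. -/

/-! ### Additive characters and Parseval's identity -/

/-- The additive character `e(x) = exp(2πix)`. -/
noncomputable def ee (x : ℝ) : ℂ := Complex.exp (2 * Real.pi * Complex.I * (x : ℝ))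

lemma ee_eq_ofReal_mul_I (x : ℝ) : ee x = Complex.exp ((2 * Real.pi * x : ℝ) * Complex.I) := by
  rw [ee]; congr 1; push_cast; ring

lemma ee_add (x y : ℝ) : ee (x + y) = ee x * ee y := by
  simp only [ee, ← Complex.exp_add]; congr 1; push_cast; ring

lemma ee_intCast (n : ℤ) : ee n = 1 := by
  rw [ee, Complex.exp_eq_one_iff]; exact ⟨n, by push_cast; ring⟩

lemma ee_natCast (n : ℕ) : ee n = 1 := by simpa using ee_intCast n

lemma ee_zero : ee 0 = 1 := by simpa using ee_intCast 0

lemma norm_ee (x : ℝ) : ‖ee x‖ = 1 := by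
  rw [ee_eq_ofReal_mul_I, Complex.norm_exp_ofReal_mul_I]

lemma star_ee (x : ℝ) : (starRingEnd ℂ) (ee x) = ee (-x) := by
  rw [ee_eq_ofReal_mul_I, ee_eq_ofReal_mul_I, ← Complex.exp_conj, map_mul, Complex.conj_ofReal,
    Complex.conj_I]
  congr 1; push_cast; ring

lemma continuous_ee : Continuous ee := by unfold ee; fun_prop

lemma ee_re (x : ℝ) : (ee x).re = Real.cos (2 * Real.pi * x) := by
  rw [ee_eq_ofReal_mul_I, Complex.exp_ofReal_mul_I_re]

/-- The trigonometric polynomial `∑_{n ∈ s} c(n) e(nθ)`. -/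
noncomputable def expPoly (s : Finset ℕ) (c : ℕ → ℂ) (θ : ℝ) : ℂ :=
  ∑ n ∈ s, c n * ee (n * θ)

lemma continuous_expPoly (s : Finset ℕ) (c : ℕ → ℂ) : Continuous (expPoly s c) := by
  have := continuous_ee
  unfold expPoly; fun_prop

lemma expPoly_add_intCast (s : Finset ℕ) (c : ℕ → ℂ) (θ : ℝ) (m : ℤ) :
    expPoly s c (θ + m) = expPoly s c θ := by
  refine Finset.sum_congr rfl fun n _ => ?_
  rw [mul_add, ee_add, show (n : ℝ) * (m : ℝ) = ((n * m : ℤ) : ℝ) by push_cast; ring, ee_intCast,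
    mul_one]

lemma norm_sq_sum_mul_ee (s : Finset ℕ) (u : ℕ → ℂ) (x : ℕ → ℝ) :
    ((‖∑ n ∈ s, u n * ee (x n)‖ ^ 2 : ℝ) : ℂ) =
      ∑ m ∈ s, ∑ n ∈ s, u m * (starRingEnd ℂ) (u n) * ee (x m - x n) := by
  rw [Complex.ofReal_pow, ← Complex.mul_conj', map_sum, Finset.sum_mul_sum]
  refine Finset.sum_congr rfl fun m _ => Finset.sum_congr rfl fun n _ => ?_
  rw [map_mul, star_ee, sub_eq_add_neg, ee_add]; ring

lemma integral_ee_int_mul {m : ℤ} (hm : m ≠ 0) (a b : ℤ) :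
    ∫ x in (a : ℝ)..b, ee (m * x) = 0 := by
  have hc : (2 * Real.pi * Complex.I * m : ℂ) ≠ 0 := by
    simp [Real.pi_ne_zero, hm]
  have h1 : ∀ x : ℝ, ee (m * x) = Complex.exp ((2 * Real.pi * Complex.I * m) * (x : ℂ)) := by
    intro x; rw [ee]; congr 1; push_cast; ring
  have h2 : ∀ a : ℤ, Complex.exp ((2 * Real.pi * Complex.I * m) * ((a : ℝ) : ℂ)) = 1 := by
    intro a
    rw [← h1, show (m : ℝ) * (a : ℝ) = ((m * a : ℤ) : ℝ) by push_cast; ring, ee_intCast]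
  simp_rw [h1]
  rw [integral_exp_mul_complex hc, h2, h2]; simp

/-- Parseval's identity over four periods. -/
lemma integral_norm_sq_expPoly (s : Finset ℕ) (c : ℕ → ℂ) :
    ∫ x in (-1 : ℝ)..3, ‖expPoly s c x‖ ^ 2 = 4 * ∑ n ∈ s, ‖c n‖ ^ 2 := by
  have h : ((∫ x in (-1 : ℝ)..3, ‖expPoly s c x‖ ^ 2 : ℝ) : ℂ) =
      ((4 * ∑ n ∈ s, ‖c n‖ ^ 2 : ℝ) : ℂ) := by
    rw [← intervalIntegral.integral_ofReal]
    simp_rw [expPoly, norm_sq_sum_mul_ee]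
    have hi' : ∀ m : ℕ, IntervalIntegrable
        (fun x : ℝ => ∑ n ∈ s, c m * (starRingEnd ℂ) (c n) * ee (m * x - n * x)) volume (-1) 3 := by
      intro m
      refine Continuous.intervalIntegrable ?_ _ _
      have := continuous_ee
      fun_prop
    have hi : ∀ m n : ℕ, IntervalIntegrable
        (fun x : ℝ => c m * (starRingEnd ℂ) (c n) * ee (m * x - n * x)) volume (-1) 3 := by
      intro m n
      refine Continuous.intervalIntegrable ?_ _ _
      have := continuous_ee
      fun_prop
    rw [intervalIntegral.integral_finsetSum (fun m _ => hi' m)]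
    rw [Complex.ofReal_mul, Complex.ofReal_sum, Finset.mul_sum]
    refine Finset.sum_congr rfl fun m hm => ?_
    rw [intervalIntegral.integral_finsetSum (fun n _ => hi m n)]
    rw [Finset.sum_eq_single_of_mem m hm]
    · simp only [sub_self, ee_zero, mul_one, intervalIntegral.integral_const]
      rw [Complex.mul_conj']; norm_num
    · intro n _ hn
      rw [intervalIntegral.integral_const_mul]
      have h0 : ((m : ℤ) - n : ℤ) ≠ 0 := by omega
      have := integral_ee_int_mul h0 (-1) 3
      have h1 : ∀ x : ℝ, ee (m * x - n * x) = ee (((m : ℤ) - n : ℤ) * x) := by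
        intro x; congr 1; push_cast; ring
      simp_rw [h1]
      push_cast at this ⊢
      rw [this, mul_zero]
  exact_mod_cast h

/-! ### The analytic large sieve -/

lemma norm_integral_sq_le {f : ℝ → ℂ} (hf : Continuous f) {a b : ℝ} (hab : a < b) :
    ‖∫ x in a..b, f x‖ ^ 2 ≤ (b - a) * ∫ x in a..b, ‖f x‖ ^ 2 := by
  set A := ∫ x in a..b, ‖f x‖ with hA
  set B := ∫ x in a..b, ‖f x‖ ^ 2 with hB
  have h1 : ‖∫ x in a..b, f x‖ ≤ A := norm_integral_le_integral_norm hab.le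
  have hpos : 0 < b - a := sub_pos.2 hab
  -- Cauchy–Schwarz, obtained from the nonnegativity of the variance of `‖f‖` about its mean `A / (b
  -- - a)`.
  have h2 : 0 ≤ ∫ x in a..b, (‖f x‖ - A / (b - a)) ^ 2 :=
    integral_nonneg hab.le fun x _ => sq_nonneg _
  have h3 : ∫ x in a..b, (‖f x‖ - A / (b - a)) ^ 2 =
      B - 2 * (A / (b - a)) * A + (A / (b - a)) ^ 2 * (b - a) := by
    have e : ∀ x, (‖f x‖ - A / (b - a)) ^ 2 =
        (‖f x‖ ^ 2 - 2 * (A / (b - a)) * ‖f x‖) + (A / (b - a)) ^ 2 := fun x => by ring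
    simp_rw [e]
    rw [intervalIntegral.integral_add, intervalIntegral.integral_sub,
      intervalIntegral.integral_const_mul, intervalIntegral.integral_const, smul_eq_mul]
    · ring
    all_goals exact Continuous.intervalIntegrable (by fun_prop) _ _
  have h4 : B - 2 * (A / (b - a)) * A + (A / (b - a)) ^ 2 * (b - a) = B - A ^ 2 / (b - a) := by
    field_simp; ring
  rw [h3, h4, sub_nonneg, div_le_iff₀ hpos] at h2
  calc ‖∫ x in a..b, f x‖ ^ 2 ≤ A ^ 2 := by gcongr
    _ ≤ _ := by linarith

/-- The Fourier transform of the window `[-w, w]` is large at low frequencies. -/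
lemma le_norm_integral_ee {w x : ℝ} (hw : 0 < w) (hx : |x| * w ≤ 1 / 6) :
    w ≤ ‖∫ y in -w..w, ee (x * y)‖ := by
  have hc : Continuous fun y : ℝ => ee (x * y) := by
    have := continuous_ee
    fun_prop
  have h1 : (∫ y in -w..w, ee (x * y)).re = ∫ y in -w..w, Real.cos (2 * Real.pi * (x * y)) := by
    have := Complex.reCLM.intervalIntegral_comp_comm (hc.intervalIntegrable (μ := volume) (-w) w)
    simp only [Complex.reCLM_apply, ee_re] at this
    exact this.symm
  refine le_trans ?_ (Complex.re_le_norm _)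
  rw [h1]
  have h2 : ∫ y in -w..w, (1 / 2 : ℝ) ≤ ∫ y in -w..w, Real.cos (2 * Real.pi * (x * y)) := by
    refine integral_mono_on (by linarith) (by simp) ?_ ?_
    · exact Continuous.intervalIntegrable (by fun_prop) _ _
    · intro y hy
      have hy' : |y| ≤ w := abs_le.2 ⟨hy.1, hy.2⟩
      have h3 : |2 * Real.pi * (x * y)| ≤ Real.pi / 3 := by
        rw [abs_mul, abs_mul x, abs_of_pos (by positivity : 0 < 2 * Real.pi)]
        have : |x| * |y| ≤ 1 / 6 := (by gcongr : |x| * |y| ≤ |x| * w).trans hx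
        nlinarith [Real.pi_pos]
      rw [← Real.cos_pi_div_three, ← Real.cos_abs (2 * Real.pi * (x * y))]
      exact Real.cos_le_cos_of_nonneg_of_le_pi (abs_nonneg _) (by linarith [Real.pi_pos]) h3
  refine le_trans (le_of_eq ?_) h2
  rw [intervalIntegral.integral_const, smul_eq_mul]; ring

/-- The analytic large sieve inequality. -/
theorem large_sieve {ι : Type*} (I : Finset ι) (x : ι → ℝ) {N : ℕ} (hN : 1 ≤ N)
    (hx : ∀ i ∈ I, x i ∈ Set.Icc (0 : ℝ) 2)
    (hsep : ∀ i ∈ I, ∀ j ∈ I, i ≠ j → 1 / (2 * (N : ℝ)) ≤ |x i - x j|)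
    (s : Finset ℕ) (hs : ∀ n ∈ s, n ≤ N) (c : ℕ → ℂ) :
    ∑ i ∈ I, ‖expPoly s c (x i)‖ ^ 2 ≤ 48 * N * ∑ n ∈ s, ‖c n‖ ^ 2 := by
  have hN0 : (1 : ℝ) ≤ N := by exact_mod_cast hN
  -- Windows of radius `w` about the points are disjoint, since `2w = 1/(3N)` is below the
  -- separation, and `n w ≤ 1/6` for all frequencies, so the window's transform is at least `w`
  -- there. The final constant is `2w · 4 / w² = 48 N`.
  set w : ℝ := 1 / (6 * N) with hw
  have hw0 : 0 < w := by positivity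
  have hw1 : w ≤ 1 / 6 := by
    rw [hw]; gcongr; linarith
  have hwN : N * w = 1 / 6 := by rw [hw]; field_simp
  set g : ℕ → ℂ := fun n => ∫ y in -w..w, ee (n * y) with hg
  have hgw : ∀ n ∈ s, w ≤ ‖g n‖ := by
    intro n hn
    refine le_norm_integral_ee hw0 ?_
    rw [Nat.abs_cast, ← hwN]
    have : (n : ℝ) ≤ N := by exact_mod_cast hs n hn
    gcongr
  -- Dividing the coefficients by the transform of the window makes the original polynomial at `x`
  -- the integral of `T` over the window about `x`.
  set T : ℝ → ℂ := expPoly s fun n => c n / g n with hT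
  have hTc : Continuous T := continuous_expPoly _ _
  have hST : ∀ x, expPoly s c x = ∫ y in (x - w)..(x + w), T y := by
    intro x
    have h0 : ∫ y in (x - w)..(x + w), T y = ∫ y in -w..w, T (y + x) := by
      rw [intervalIntegral.integral_comp_add_right (fun y => T y)]; congr 1 <;> ring
    rw [h0]
    have h1 : ∀ y, T (y + x) = ∑ n ∈ s, (c n / g n * ee (n * x)) * ee (n * y) := by
      intro y
      refine Finset.sum_congr rfl fun n _ => ?_
      rw [mul_add, ee_add]; ring
    simp_rw [h1]
    rw [intervalIntegral.integral_finsetSum]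
    · refine Finset.sum_congr rfl fun n hn => ?_
      have : g n ≠ 0 := norm_pos_iff.1 (hw0.trans_le (hgw n hn))
      rw [intervalIntegral.integral_const_mul]
      change _ = _ * g n
      field_simp
    · intro n _
      refine Continuous.intervalIntegrable ?_ _ _
      have := continuous_ee
      fun_prop
  have hint : IntegrableOn (fun y => ‖T y‖ ^ 2) (Set.Ioc (-1) 3) :=
    (Continuous.integrableOn_Icc (by fun_prop)).mono_set Set.Ioc_subset_Icc_self
  have hsub : ∀ i ∈ I, Set.Ioc (x i - w) (x i + w) ⊆ Set.Ioc (-1) 3 := by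
    intro i hi
    exact Set.Ioc_subset_Ioc (by linarith [(hx i hi).1]) (by linarith [(hx i hi).2])
  have hdisj : (I : Set ι).PairwiseDisjoint fun i => Set.Ioc (x i - w) (x i + w) := by
    intro i hi j hj hij
    refine Set.disjoint_left.2 fun y hy1 hy2 => ?_
    have h1 := hsep i hi j hj hij
    have h2 : |x i - x j| < 2 * w := by
      rw [abs_lt]
      constructor <;> linarith [hy1.1, hy1.2, hy2.1, hy2.2]
    have h3 : 2 * w ≤ 1 / (2 * (N : ℝ)) := by
      rw [hw, mul_one_div, div_le_div_iff₀ (by positivity) (by positivity)]; linarith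
    linarith
  have hsum : ∑ i ∈ I, ∫ y in (x i - w)..(x i + w), ‖T y‖ ^ 2 ≤
      ∫ y in (-1 : ℝ)..3, ‖T y‖ ^ 2 := by
    have h1 : ∀ i ∈ I, ∫ y in (x i - w)..(x i + w), ‖T y‖ ^ 2 =
        ∫ y in Set.Ioc (x i - w) (x i + w), ‖T y‖ ^ 2 := fun i _ =>
      intervalIntegral.integral_of_le (by linarith)
    rw [Finset.sum_congr rfl h1, intervalIntegral.integral_of_le (by norm_num),
      ← integral_biUnion_finset I (fun i _ => measurableSet_Ioc) hdisj
        (fun i hi => hint.mono_set (hsub i hi))]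
    refine setIntegral_mono_set hint (Filter.Eventually.of_forall fun y => by positivity) ?_
    exact (Set.iUnion₂_subset hsub).eventuallyLE
  calc ∑ i ∈ I, ‖expPoly s c (x i)‖ ^ 2
      ≤ ∑ i ∈ I, (2 * w) * ∫ y in (x i - w)..(x i + w), ‖T y‖ ^ 2 := by
        refine Finset.sum_le_sum fun i _ => ?_
        rw [hST]
        refine (norm_integral_sq_le hTc (by linarith)).trans (le_of_eq ?_)
        congr 1; ring
    _ ≤ (2 * w) * (4 * ∑ n ∈ s, ‖c n / g n‖ ^ 2) := by
        rw [← Finset.mul_sum, ← integral_norm_sq_expPoly]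
        gcongr
    _ ≤ (2 * w) * (4 * ∑ n ∈ s, (‖c n‖ / w) ^ 2) := by
        gcongr with n hn
        rw [norm_div]
        gcongr
        exact hgw n hn
    _ = 48 * N * ∑ n ∈ s, ‖c n‖ ^ 2 := by
        have : ∀ n, (‖c n‖ / w) ^ 2 = ‖c n‖ ^ 2 * (1 / w ^ 2) := fun n => by
          rw [div_pow]; ring
        simp_rw [this, ← Finset.sum_mul]
        have h6 : 1 / w ^ 2 = 36 * N ^ 2 := by rw [hw]; field_simp; norm_num
        rw [h6, hw]; field_simp; ring

/-! ### Residue classes, Farey fractions and Montgomery's inequality -/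

lemma ee_nat_mul (n : ℕ) (x : ℝ) : ee (n * x) = ee x ^ n := by
  rw [ee, ee, ← Complex.exp_nat_mul]; congr 1; push_cast; ring

lemma ee_eq_one_iff (x : ℝ) : ee x = 1 ↔ ∃ n : ℤ, x = n := by
  constructor
  · intro h
    rw [ee, Complex.exp_eq_one_iff] at h
    obtain ⟨n, hn⟩ := h
    refine ⟨n, ?_⟩
    have h1 : (2 * Real.pi * Complex.I : ℂ) ≠ 0 := by simp [Real.pi_ne_zero]
    have h2 : (2 * Real.pi * Complex.I : ℂ) * x = (2 * Real.pi * Complex.I) * n := by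
      rw [hn]; ring
    exact_mod_cast mul_left_cancel₀ h1 h2
  · rintro ⟨n, rfl⟩
    exact ee_intCast n

/-- Orthogonality modulo `q`: for `c ≠ d` this is a geometric series whose ratio `e((c - d)/q)` is a
nontrivial `q`-th root of unity. -/
lemma sum_ee_sub_mul_div {q c d : ℕ} (hc : c < q) (hd : d < q) :
    ∑ a ∈ range q, ee (c * (a / q) - d * (a / q)) = if c = d then (q : ℂ) else 0 := by
  have hq : (q : ℝ) ≠ 0 := by
    have : q ≠ 0 := by omega
    exact_mod_cast this
  split_ifs with h
  · subst h; simp [ee_zero]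
  · have h1 : ∀ a : ℕ, ee (c * (a / q) - d * (a / q)) = ee ((c - d) / q) ^ a := by
      intro a; rw [← ee_nat_mul]; congr 1; ring
    simp_rw [h1]
    have hne : ee (((c : ℝ) - d) / q) ≠ 1 := by
      rw [Ne, ee_eq_one_iff]
      rintro ⟨n, hn⟩
      rw [div_eq_iff hq] at hn
      have hn' : ((c : ℤ) - d) = n * q := by exact_mod_cast hn
      have : (c : ℤ) - d = 0 := by
        refine Int.eq_zero_of_abs_lt_dvd (m := q) ⟨n, by rw [hn']; ring⟩ ?_
        rw [abs_lt]; constructor <;> omega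
      omega
    rw [geom_sum_eq hne, ← ee_nat_mul]
    have : (q : ℝ) * (((c : ℝ) - d) / q) = ((c - d : ℤ) : ℝ) := by push_cast; field_simp
    rw [this, ee_intCast]; simp

/-- If the support of `c` meets only the residue classes in `W` modulo `q`, then
`q |h(θ)|² ≤ |W| ∑_a |h(θ + a/q)|²`. -/
lemma mul_norm_sq_expPoly_le {q : ℕ} (hq : 0 < q) {W : Finset ℕ} (hW : W ⊆ range q)
    (s : Finset ℕ) (hs : ∀ n ∈ s, n % q ∈ W) (c : ℕ → ℂ) (θ : ℝ) :
    q * ‖expPoly s c θ‖ ^ 2 ≤ #W * ∑ a ∈ range q, ‖expPoly s c (θ + (a : ℝ) / q)‖ ^ 2 := by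
  have hq0 : (q : ℝ) ≠ 0 := by positivity
  -- Split the sum by residue class: translating by `a/q` multiplies the class `r` by `e(ra/q)`.
  -- Orthogonality evaluates the sum over `a`, and Cauchy–Schwarz over `W` gives the factor `#W`.
  set Z : ℕ → ℂ := fun r => ∑ n ∈ s with n % q = r, c n * ee (n * θ) with hZ
  have h1 : ∀ a : ℕ, expPoly s c (θ + (a : ℝ) / q) = ∑ r ∈ W, Z r * ee (r * (a / q)) := by
    intro a
    rw [expPoly, ← Finset.sum_fiberwise_of_maps_to hs]
    refine Finset.sum_congr rfl fun r _ => ?_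
    rw [hZ, Finset.sum_mul]
    refine Finset.sum_congr rfl fun n hn => ?_
    have hr : n % q = r := (Finset.mem_filter.1 hn).2
    have h2 : (n : ℝ) = q * (n / q : ℕ) + r := by
      have := Nat.div_add_mod n q
      rw [hr] at this
      exact_mod_cast this.symm
    have h3 : (n : ℝ) * (θ + (a : ℝ) / q) = n * θ + (r * (a / q) + ((n / q * a : ℕ) : ℝ)) := by
      rw [mul_add, add_right_inj]
      nth_rewrite 1 [h2]
      push_cast; field_simp; ring
    rw [h3, ee_add, ee_add _ ((n / q * a : ℕ) : ℝ), ee_natCast, mul_one, mul_assoc]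
  have h0 : expPoly s c θ = ∑ r ∈ W, Z r := by
    have := h1 0
    simpa [ee_zero] using this
  have h2 : ∑ a ∈ range q, ‖expPoly s c (θ + (a : ℝ) / q)‖ ^ 2 = q * ∑ r ∈ W, ‖Z r‖ ^ 2 := by
    have : ((∑ a ∈ range q, ‖expPoly s c (θ + (a : ℝ) / q)‖ ^ 2 : ℝ) : ℂ) =
        ((q * ∑ r ∈ W, ‖Z r‖ ^ 2 : ℝ) : ℂ) := by
      rw [Complex.ofReal_sum]
      simp_rw [h1, norm_sq_sum_mul_ee]
      rw [Finset.sum_comm, Complex.ofReal_mul, Complex.ofReal_sum, Finset.mul_sum]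
      refine Finset.sum_congr rfl fun r hr => ?_
      rw [Finset.sum_comm]
      simp_rw [← Finset.mul_sum]
      rw [Finset.sum_congr rfl fun d hd =>
        by rw [sum_ee_sub_mul_div (mem_range.1 (hW hr)) (mem_range.1 (hW hd))]]
      simp only [mul_ite, mul_zero, Finset.sum_ite_eq, hr, if_true]
      rw [Complex.mul_conj']; push_cast; ring
    exact_mod_cast this
  rw [h2, h0]
  have h3 : ‖∑ r ∈ W, Z r‖ ^ 2 ≤ #W * ∑ r ∈ W, ‖Z r‖ ^ 2 :=
    (by gcongr; exact norm_sum_le _ _ : ‖∑ r ∈ W, Z r‖ ^ 2 ≤ (∑ r ∈ W, ‖Z r‖) ^ 2).trans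
      sq_sum_le_card_mul_sum_sq
  calc _ ≤ (q : ℝ) * (#W * ∑ r ∈ W, ‖Z r‖ ^ 2) := by gcongr
    _ = _ := by ring

/-- The rationals in `[0, 1)` with denominator `q`. -/
def farey (q : ℕ) : Finset ℚ :=
  ((range q).image fun a : ℕ => (a : ℚ) / q).filter fun x => x.den = q

lemma mem_farey {q : ℕ} {x : ℚ} : x ∈ farey q ↔ 0 ≤ x ∧ x < 1 ∧ x.den = q := by
  simp only [farey, mem_filter, mem_image, mem_range]
  constructor
  · rintro ⟨⟨a, ha, rfl⟩, hd⟩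
    have hq : (0 : ℚ) < q := by exact_mod_cast (by omega : 0 < q)
    refine ⟨by positivity, ?_, hd⟩
    rw [div_lt_one hq]; exact_mod_cast ha
  · rintro ⟨h0, h1, hd⟩
    have hq : (0 : ℚ) < q := by rw [← hd]; exact_mod_cast x.pos
    have hnum : 0 ≤ x.num := Rat.num_nonneg.2 h0
    have hx : x = (x.num.toNat : ℚ) / q := by
      conv_lhs => rw [← Rat.num_div_den x]
      rw [hd]; congr 1
      exact_mod_cast (Int.toNat_of_nonneg hnum).symm
    refine ⟨⟨x.num.toNat, ?_, hx.symm⟩, hd⟩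
    rw [hx, div_lt_one hq] at h1
    exact_mod_cast h1

lemma farey_one : farey 1 = {0} := by
  ext x
  rw [mem_farey, mem_singleton]
  constructor
  · rintro ⟨h0, h1, hd⟩
    have := Rat.den_eq_one_iff x |>.1 hd
    rw [← this] at h0 h1 ⊢
    have a : 0 ≤ x.num := by exact_mod_cast h0
    have b : x.num < 1 := by exact_mod_cast h1
    have : x.num = 0 := by omega
    simp [this]
  · rintro rfl; simp

lemma sum_farey_prime {p : ℕ} (hp : p.Prime) (g : ℚ → ℝ) :
    ∑ a ∈ range p, g ((a : ℚ) / p) = g 0 + ∑ x ∈ farey p, g x := by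
  have hp0 : (p : ℚ) ≠ 0 := by exact_mod_cast hp.ne_zero
  have hinj : Set.InjOn (fun a : ℕ => (a : ℚ) / p) (range p) := by
    intro a _ b _ h
    have := (div_left_inj' hp0).1 h
    exact_mod_cast this
  rw [farey, ← Finset.sum_image (f := g) hinj,
    ← Finset.sum_filter_add_sum_filter_not ((range p).image fun a : ℕ => (a : ℚ) / p)
      (fun x => x.den = p), add_comm]
  congr 1
  have : ((range p).image fun a : ℕ => (a : ℚ) / p).filter (fun x => ¬ x.den = p) = {0} := by
    ext x
    simp only [mem_filter, mem_image, mem_range, mem_singleton]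
    constructor
    · rintro ⟨⟨a, ha, rfl⟩, hd⟩
      by_contra h0
      have ha0 : a ≠ 0 := by rintro rfl; simp at h0
      refine hd ?_
      have hcop : Nat.Coprime a p :=
        (Nat.coprime_of_lt_prime ha0 ha hp).symm
      have := Rat.den_div_eq_of_coprime (a := a) (b := p) (by exact_mod_cast hp.pos) (by simpa)
      exact_mod_cast this
    · rintro rfl
      exact ⟨⟨0, hp.pos, by simp⟩, by simpa using hp.one_lt.ne⟩
  rw [this, Finset.sum_singleton]

lemma den_add_of_coprime {x y : ℚ} (h : Nat.Coprime x.den y.den) :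
    (x + y).den = x.den * y.den := by
  refine Nat.dvd_antisymm (Rat.add_den_dvd x y) (h.mul_dvd_of_dvd_of_dvd ?_ ?_)
  · have h1 : x.den ∣ (x + y).den * y.den := by
      have := Rat.sub_den_dvd (x + y) y
      rwa [add_sub_cancel_right] at this
    exact h.dvd_of_dvd_mul_right h1
  · have h1 : y.den ∣ (x + y).den * x.den := by
      have := Rat.sub_den_dvd (x + y) x
      rwa [add_sub_cancel_left] at this
    exact h.symm.dvd_of_dvd_mul_right h1

lemma den_fract (x : ℚ) : (Int.fract x).den = x.den := by
  rw [← Int.self_sub_floor, sub_eq_add_neg, ← Int.cast_neg, Rat.add_intCast_den]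

lemma eq_of_den_sub_eq_one {x y : ℚ} (hx0 : 0 ≤ x) (hx1 : x < 1) (hy0 : 0 ≤ y) (hy1 : y < 1)
    (h : (x - y).den = 1) : x = y := by
  have h1 := (Rat.den_eq_one_iff _).1 h
  have a : ((x - y).num : ℚ) < 1 := by rw [h1]; linarith
  have b : (-1 : ℚ) < ((x - y).num : ℚ) := by rw [h1]; linarith
  have a' : (x - y).num < 1 := by exact_mod_cast a
  have b' : -1 < (x - y).num := by exact_mod_cast b
  have : (x - y).num = 0 := by omega
  rw [this] at h1
  push_cast at h1
  linarith

/-- Chinese remainder theorem on the circle: for coprime `q` and `r`, adding modulo 1 maps pairs of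
fractions injectively into fractions of denominator `qr`. If two pairs have equal sums modulo 1,
their coordinate differences have a denominator dividing both `q²` and `r²`, hence equal to 1. -/
lemma sum_farey_mul_le {q r : ℕ} (hqr : Nat.Coprime q r) {g : ℚ → ℝ} (hg : ∀ x, 0 ≤ g x)
    (hper : ∀ (x : ℚ) (m : ℤ), g (x + m) = g x) :
    ∑ x ∈ farey q, ∑ y ∈ farey r, g (x + y) ≤ ∑ z ∈ farey (q * r), g z := by
  rw [← Finset.sum_product']
  have hper' : ∀ x, g (Int.fract x) = g x := fun x => by
    rw [← Int.self_sub_floor, sub_eq_add_neg, ← Int.cast_neg, hper]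
  have hinj : Set.InjOn (fun v : ℚ × ℚ => Int.fract (v.1 + v.2))
      (farey q ×ˢ farey r : Finset (ℚ × ℚ)) := by
    rintro ⟨x, y⟩ h ⟨x', y'⟩ h' e
    simp only [coe_product, Set.mem_prod, mem_coe, mem_farey] at h h' e
    obtain ⟨⟨hx0, hx1, hxd⟩, hy0, hy1, hyd⟩ := h
    obtain ⟨⟨hx0', hx1', hxd'⟩, hy0', hy1', hyd'⟩ := h'
    obtain ⟨m, hm⟩ := Int.fract_eq_fract.1 e
    have h1 : x - x' = (y' - y) + (m : ℤ) := by linarith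
    have hd1 : (x - x').den = (y' - y).den := by rw [h1, Rat.add_intCast_den]
    have hq : (x - x').den ∣ q * q := by
      have := Rat.sub_den_dvd x x'; rwa [hxd, hxd'] at this
    have hr : (x - x').den ∣ r * r := by
      have := Rat.sub_den_dvd y' y; rwa [hyd, hyd', ← hd1] at this
    have hone : (x - x').den = 1 :=
      Nat.eq_one_of_dvd_coprimes
        (Nat.Coprime.mul_left (hqr.mul_right hqr) (hqr.mul_right hqr)) hq hr
    have ex := eq_of_den_sub_eq_one hx0 hx1 hx0' hx1' hone
    have ey := eq_of_den_sub_eq_one hy0' hy1' hy0 hy1 (hd1 ▸ hone)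
    rw [ex, ey]
  calc ∑ v ∈ farey q ×ˢ farey r, g (v.1 + v.2)
      = ∑ v ∈ farey q ×ˢ farey r, g (Int.fract (v.1 + v.2)) := by simp_rw [hper']
    _ = ∑ z ∈ (farey q ×ˢ farey r).image fun v => Int.fract (v.1 + v.2), g z :=
        (Finset.sum_image (f := g) hinj).symm
    _ ≤ _ := by
        refine Finset.sum_le_sum_of_subset_of_nonneg ?_ fun _ _ _ => hg _
        intro z hz
        simp only [mem_image, mem_product, mem_farey] at hz
        obtain ⟨⟨x, y⟩, ⟨⟨hx0, hx1, hxd⟩, hy0, hy1, hyd⟩, rfl⟩ := hz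
        refine mem_farey.2 ⟨Int.fract_nonneg _, Int.fract_lt_one _, ?_⟩
        simp only at hxd hyd ⊢
        rw [den_fract, den_add_of_coprime (by rwa [hxd, hyd]), hxd, hyd]

/-- Montgomery's inequality. The support of the coefficients meets only the classes `W p` modulo
each prime `p ∈ S`. -/
theorem montgomery (S : Finset ℕ) (hS : ∀ p ∈ S, p.Prime) (W : ℕ → Finset ℕ)
    (hW : ∀ p ∈ S, W p ⊆ range p) (hW0 : ∀ p ∈ S, (W p).Nonempty)
    (s : Finset ℕ) (hs : ∀ p ∈ S, ∀ n ∈ s, n % p ∈ W p) (c : ℕ → ℂ) (θ : ℝ) :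
    (∏ p ∈ S, ((p : ℝ) / #(W p) - 1)) * ‖expPoly s c θ‖ ^ 2 ≤
      ∑ x ∈ farey (∏ p ∈ S, p), ‖expPoly s c (θ + (x : ℝ))‖ ^ 2 := by
  induction S using Finset.induction_on generalizing θ with
  | empty => simp [farey_one]
  | insert p S hpS ih =>
    have hp : p.Prime := hS p (mem_insert_self _ _)
    have ih' := ih (fun q hq => hS q (mem_insert_of_mem hq)) (fun q hq => hW q (mem_insert_of_mem hq))
      (fun q hq => hW0 q (mem_insert_of_mem hq)) (fun q hq => hs q (mem_insert_of_mem hq))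
    have hWp : W p ⊆ range p := hW p (mem_insert_self _ _)
    have hcard : (0 : ℝ) < #(W p) := by
      exact_mod_cast Finset.card_pos.2 (hW0 p (mem_insert_self _ _))
    have hcardle : (#(W p) : ℝ) ≤ p := by
      have := Finset.card_le_card hWp
      rw [card_range] at this
      exact_mod_cast this
    -- The term `a = 0` is `‖expPoly s c t‖ ^ 2` itself; moving it to the left produces the `-1` in
    -- the weight.
    have hprime : ∀ t : ℝ, ((p : ℝ) / #(W p) - 1) * ‖expPoly s c t‖ ^ 2 ≤
        ∑ x ∈ farey p, ‖expPoly s c (t + (x : ℝ))‖ ^ 2 := by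
      intro t
      have h1 := mul_norm_sq_expPoly_le hp.pos hWp s (hs p (mem_insert_self _ _)) c t
      have h2 := sum_farey_prime hp fun x : ℚ => ‖expPoly s c (t + (x : ℝ))‖ ^ 2
      push_cast at h2
      rw [h2, add_zero] at h1
      rw [sub_mul, one_mul, sub_le_iff_le_add, div_mul_eq_mul_div, div_le_iff₀ hcard]
      linarith
    have hcop : Nat.Coprime p (∏ q ∈ S, q) := by
      refine Nat.Coprime.prod_right fun q hq => ?_
      rw [Nat.coprime_primes hp (hS q (mem_insert_of_mem hq))]
      rintro rfl; exact hpS hq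
    rw [Finset.prod_insert hpS, Finset.prod_insert hpS]
    calc _ = (∏ q ∈ S, ((q : ℝ) / #(W q) - 1)) * (((p : ℝ) / #(W p) - 1) * ‖expPoly s c θ‖ ^ 2) := by
          ring
      _ ≤ (∏ q ∈ S, ((q : ℝ) / #(W q) - 1)) *
            ∑ x ∈ farey p, ‖expPoly s c (θ + (x : ℝ))‖ ^ 2 := by
          refine mul_le_mul_of_nonneg_left (hprime θ) (Finset.prod_nonneg fun q hq => ?_)
          have h1 : (0 : ℝ) < #(W q) := by
            exact_mod_cast Finset.card_pos.2 (hW0 q (mem_insert_of_mem hq))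
          have h2 : (#(W q) : ℝ) ≤ q := by
            have := Finset.card_le_card (hW q (mem_insert_of_mem hq))
            rw [card_range] at this
            exact_mod_cast this
          rw [sub_nonneg, one_le_div h1]; exact h2
      _ ≤ ∑ x ∈ farey p, ∑ y ∈ farey (∏ q ∈ S, q), ‖expPoly s c (θ + ((x + y : ℚ) : ℝ))‖ ^ 2 := by
          rw [Finset.mul_sum]
          refine Finset.sum_le_sum fun x _ => (ih' _).trans (le_of_eq ?_)
          refine Finset.sum_congr rfl fun y _ => ?_
          push_cast; rw [add_assoc]
      _ ≤ _ := by
          refine sum_farey_mul_le hcop (g := fun x => ‖expPoly s c (θ + (x : ℝ))‖ ^ 2)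
            (fun _ => by positivity) fun x m => ?_
          push_cast
          rw [← add_assoc, expPoly_add_intCast]

/-! ### The large sieve at several points, outside exceptional primes -/

lemma one_div_den_le_abs {z : ℚ} (hz : z ≠ 0) : 1 / (z.den : ℝ) ≤ |(z : ℝ)| := by
  have hd : (0 : ℝ) < z.den := by exact_mod_cast z.pos
  have h1 : (z : ℝ) = z.num / z.den := by exact_mod_cast (Rat.num_div_den z).symm
  rw [h1, abs_div, abs_of_pos hd]
  gcongr
  have : 1 ≤ |z.num| := Int.one_le_abs (Rat.num_ne_zero.2 hz)
  exact_mod_cast this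

lemma one_div_le_abs_sub {x y : ℚ} (h : x ≠ y) {A B : ℝ} (hA : (x.den : ℝ) ≤ A)
    (hB : (y.den : ℝ) ≤ B) : 1 / (A * B) ≤ |(x : ℝ) - y| := by
  have h1 := one_div_den_le_abs (sub_ne_zero.2 h)
  push_cast at h1
  refine le_trans ?_ h1
  have hpos : (0 : ℝ) < (x - y).den := by exact_mod_cast (x - y).pos
  have h2 : ((x - y).den : ℝ) ≤ x.den * y.den := by
    exact_mod_cast Nat.le_of_dvd (Nat.mul_pos x.pos y.pos) (Rat.sub_den_dvd x y)
  refine one_div_le_one_div_of_le hpos (h2.trans ?_)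
  have : (0 : ℝ) ≤ A := (Nat.cast_nonneg _).trans hA
  gcongr

/-- For distinct separated points, the coincidences between their Farey translates all involve a
single prime. -/
lemma exists_prime_dvd_of_close {N : ℕ} (hN : 1 ≤ N) {Q : ℝ} (hQN : Q ^ 4 ≤ N) {u v : ℝ}
    (hsep : 1 / (N : ℝ) ≤ |u - v|) :
    ∃ p : ℕ, p.Prime ∧ ∀ q r : ℕ, (q : ℝ) ≤ Q → (r : ℝ) ≤ Q → ∀ x ∈ farey q, ∀ y ∈ farey r,
      |(u + (x : ℝ)) - (v + y)| < 1 / (2 * (N : ℝ)) → p ∣ q * r := by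
  by_cases H : ∃ q r : ℕ, (q : ℝ) ≤ Q ∧ (r : ℝ) ≤ Q ∧ ∃ x ∈ farey q, ∃ y ∈ farey r,
      |(u + (x : ℝ)) - (v + y)| < 1 / (2 * (N : ℝ))
  swap
  · push Not at H
    refine ⟨2, Nat.prime_two, fun q r hq hr x hx y hy h => ?_⟩
    exact absurd h (not_lt.2 (H q r hq hr x hx y hy))
  obtain ⟨q, r, hq, hr, x, hx, y, hy, hxy⟩ := H
  have hN0 : (0 : ℝ) < N := by exact_mod_cast hN
  have hhalf : 1 / (2 * (N : ℝ)) + 1 / (2 * (N : ℝ)) = 1 / N := by field_simp; norm_num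
  have hhalf0 : 0 < 1 / (2 * (N : ℝ)) := by positivity
  have hden : ∀ q r : ℕ, (q : ℝ) ≤ Q → (r : ℝ) ≤ Q → ∀ x ∈ farey q, ∀ y ∈ farey r,
      ((x - y).den : ℝ) ≤ Q ^ 2 := by
    intro q r hq hr x hx y hy
    have h1 := Nat.le_of_dvd (Nat.mul_pos x.pos y.pos) (Rat.sub_den_dvd x y)
    rw [(mem_farey.1 hx).2.2, (mem_farey.1 hy).2.2] at h1
    have h2 : ((x - y).den : ℝ) ≤ q * r := by exact_mod_cast h1
    have : (0 : ℝ) ≤ Q := (Nat.cast_nonneg _).trans hq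
    calc _ ≤ (q : ℝ) * r := h2
      _ ≤ Q * Q := by gcongr
      _ = Q ^ 2 := by ring
  -- An integral difference would force `x = y`, and then `u` and `v` would be too close.
  have hne : (x - y).den ≠ 1 := by
    intro h
    have := eq_of_den_sub_eq_one (mem_farey.1 hx).1 (mem_farey.1 hx).2.1 (mem_farey.1 hy).1
      (mem_farey.1 hy).2.1 h
    rw [this, add_sub_add_right_eq_sub] at hxy
    linarith
  refine ⟨(x - y).den.minFac, Nat.minFac_prime hne, fun q' r' hq' hr' x' hx' y' hy' h' => ?_⟩
  -- Both differences lie within `1/(2N)` of `v - u`, while distinct rationals with denominators at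
  -- most `Q²` differ by at least `Q⁻⁴ ≥ 1/N`.
  have heq : x' - y' = x - y := by
    by_contra hn
    have h1 := one_div_le_abs_sub hn (hden _ _ hq' hr' _ hx' _ hy') (hden _ _ hq hr _ hx _ hy)
    have hQ0 : 0 < Q := lt_of_lt_of_le
      (by rw [← (mem_farey.1 hx).2.2]; exact_mod_cast x.pos) hq
    have h2 : 1 / (N : ℝ) ≤ 1 / (Q ^ 2 * Q ^ 2) := by
      refine one_div_le_one_div_of_le (by positivity) (le_trans (le_of_eq ?_) hQN); ring
    have h3 : |((x' - y' : ℚ) : ℝ) - ((x - y : ℚ) : ℝ)| < 1 / N := by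
      rw [← hhalf]
      push_cast
      have := abs_sub ((u + (x' : ℝ)) - (v + y')) ((u + (x : ℝ)) - (v + y))
      have e : (u + (x' : ℝ)) - (v + y') - ((u + (x : ℝ)) - (v + y)) = (x' - y') - (x - y) := by
        ring
      rw [e] at this
      linarith
    linarith
  have h1 := Rat.sub_den_dvd x' y'
  rw [heq, (mem_farey.1 hx').2.2, (mem_farey.1 hy').2.2] at h1
  exact (Nat.minFac_dvd _).trans h1

/-- One prime per ordered pair of points suffices, whence the bound `#I ^ 2`. A pair without
coincidences receives the dummy prime 2. -/
lemma exists_exceptional_primes {ι : Type*} [DecidableEq ι] (I : Finset ι) (θ : ι → ℝ) {N : ℕ}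
    (hN : 1 ≤ N) {Q : ℝ} (hQN : Q ^ 4 ≤ N)
    (hsep : ∀ i ∈ I, ∀ j ∈ I, i ≠ j → 1 / (N : ℝ) ≤ |θ i - θ j|) :
    ∃ E : Finset ℕ, (∀ p ∈ E, p.Prime) ∧ #E ≤ #I ^ 2 ∧ ∀ i ∈ I, ∀ j ∈ I, i ≠ j →
      ∀ q r : ℕ, (q : ℝ) ≤ Q → (r : ℝ) ≤ Q → (∀ p ∈ E, ¬ p ∣ q) → (∀ p ∈ E, ¬ p ∣ r) →
      ∀ x ∈ farey q, ∀ y ∈ farey r, 1 / (2 * (N : ℝ)) ≤ |(θ i + (x : ℝ)) - (θ j + y)| := by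
  have key : ∀ v : ι × ι, ∃ p : ℕ, p.Prime ∧ (v.1 ∈ I → v.2 ∈ I → v.1 ≠ v.2 →
      ∀ q r : ℕ, (q : ℝ) ≤ Q → (r : ℝ) ≤ Q → ∀ x ∈ farey q, ∀ y ∈ farey r,
      |(θ v.1 + (x : ℝ)) - (θ v.2 + y)| < 1 / (2 * (N : ℝ)) → p ∣ q * r) := by
    rintro ⟨i, j⟩
    by_cases h : i ∈ I ∧ j ∈ I ∧ i ≠ j
    · obtain ⟨hi, hj, hij⟩ := h
      obtain ⟨p, hp, hp'⟩ := exists_prime_dvd_of_close hN hQN (hsep i hi j hj hij)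
      exact ⟨p, hp, fun _ _ _ => hp'⟩
    · exact ⟨2, Nat.prime_two, fun h1 h2 h3 => absurd ⟨h1, h2, h3⟩ h⟩
  choose p hp hdvd using key
  refine ⟨(I ×ˢ I).image p, ?_, ?_, ?_⟩
  · intro l hl
    obtain ⟨v, _, rfl⟩ := mem_image.1 hl
    exact hp v
  · exact card_image_le.trans (by rw [card_product, sq])
  · intro i hi j hj hij q r hq hr hqE hrE x hx y hy
    by_contra! hlt
    have h1 := hdvd (i, j) hi hj hij q r hq hr x hx y hy hlt
    have hmem : p (i, j) ∈ (I ×ˢ I).image p := mem_image_of_mem _ (mem_product.2 ⟨hi, hj⟩)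
    rcases (hp (i, j)).dvd_mul.1 h1 with h | h
    · exact hqE _ hmem h
    · exact hrE _ hmem h

/-- The large sieve at several separated points, after the removal of few primes. -/
theorem exists_sieve_sum_mul_le {ι : Type*} [DecidableEq ι] (I : Finset ι) (θ : ι → ℝ) {N : ℕ}
    (hN : 1 ≤ N) {Q : ℝ} (hQ : 1 ≤ Q) (hQN : Q ^ 4 ≤ N) (hθ : ∀ i ∈ I, θ i ∈ Set.Icc (0 : ℝ) 1)
    (hsep : ∀ i ∈ I, ∀ j ∈ I, i ≠ j → 1 / (N : ℝ) ≤ |θ i - θ j|)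
    (P : Finset ℕ) (hP : ∀ p ∈ P, p.Prime) (W : ℕ → Finset ℕ)
    (hW : ∀ p ∈ P, W p ⊆ range p) (hW0 : ∀ p ∈ P, (W p).Nonempty)
    (s : Finset ℕ) (hsN : ∀ n ∈ s, n ≤ N) (hs : ∀ p ∈ P, ∀ n ∈ s, n % p ∈ W p) (c : ℕ → ℂ) :
    ∃ E : Finset ℕ, (∀ p ∈ E, p.Prime) ∧ #E ≤ #I ^ 2 ∧
      (∑ S ∈ (P \ E).powerset with ((∏ p ∈ S, p : ℕ) : ℝ) ≤ Q, ∏ p ∈ S, ((p : ℝ) / #(W p) - 1)) *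
        ∑ i ∈ I, ‖expPoly s c (θ i)‖ ^ 2 ≤ 48 * N * ∑ n ∈ s, ‖c n‖ ^ 2 := by
  obtain ⟨E, hE, hcard, hEsep⟩ := exists_exceptional_primes I θ hN hQN hsep
  refine ⟨E, hE, hcard, ?_⟩
  set 𝒮 := (P \ E).powerset.filter fun S => ((∏ p ∈ S, p : ℕ) : ℝ) ≤ Q with h𝒮
  have hmem : ∀ S ∈ 𝒮, S ⊆ P ∧ (∀ p ∈ S, p ∉ E) ∧ ((∏ p ∈ S, p : ℕ) : ℝ) ≤ Q := by
    intro S hS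
    obtain ⟨h1, h2⟩ := mem_filter.1 hS
    have h3 := mem_powerset.1 h1
    exact ⟨h3.trans sdiff_subset, fun p hp => (mem_sdiff.1 (h3 hp)).2, h2⟩
  have hpf : ∀ S ∈ 𝒮, (∏ p ∈ S, p).primeFactors = S := fun S hS =>
    Nat.primeFactors_prod fun p hp => hP p ((hmem S hS).1 hp)
  have hdisj : (𝒮 : Set (Finset ℕ)).PairwiseDisjoint fun S => farey (∏ p ∈ S, p) := by
    intro S hS T hT hST
    refine Finset.disjoint_left.2 fun x hx hx' => hST ?_
    rw [← hpf S hS, ← hpf T hT, ← (mem_farey.1 hx).2.2, ← (mem_farey.1 hx').2.2]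
  set X := 𝒮.biUnion fun S => farey (∏ p ∈ S, p) with hX
  have hXmem : ∀ x ∈ X, (x.den : ℝ) ≤ Q ∧ x ∈ farey x.den ∧ ∀ p ∈ E, ¬ p ∣ x.den := by
    intro x hx
    obtain ⟨S, hS, hxS⟩ := mem_biUnion.1 hx
    have hd := (mem_farey.1 hxS).2.2
    refine ⟨by rw [hd]; exact (hmem S hS).2.2, by rw [hd]; exact hxS, fun p hp hpd => ?_⟩
    have : p ∈ (∏ p ∈ S, p).primeFactors := by
      rw [Nat.mem_primeFactors, ← hd]; exact ⟨hE p hp, hpd, x.den_nz⟩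
    rw [hpf S hS] at this
    exact (hmem S hS).2.1 p this hp
  have hN0 : (0 : ℝ) < N := by exact_mod_cast hN
  have hLS := large_sieve (I ×ˢ X) (fun v : ι × ℚ => θ v.1 + (v.2 : ℝ)) hN ?_ ?_ s hsN c
  · refine le_trans ?_ hLS
    rw [Finset.sum_product, Finset.mul_sum]
    refine Finset.sum_le_sum fun i _ => ?_
    rw [hX, Finset.sum_biUnion hdisj, Finset.sum_mul]
    refine Finset.sum_le_sum fun S hS => ?_
    have hSP := (hmem S hS).1
    exact montgomery S (fun p hp => hP p (hSP hp)) W (fun p hp => hW p (hSP hp))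
      (fun p hp => hW0 p (hSP hp)) s (fun p hp => hs p (hSP hp)) c (θ i)
  · rintro ⟨i, x⟩ h
    obtain ⟨hi, hx⟩ := mem_product.1 h
    obtain ⟨h0, h1, _⟩ := mem_farey.1 (hXmem x hx).2.1
    have h0' : (0 : ℝ) ≤ x := by exact_mod_cast h0
    have h1' : (x : ℝ) < 1 := by exact_mod_cast h1
    constructor <;> simp only <;> linarith [(hθ i hi).1, (hθ i hi).2]
  · rintro ⟨i, x⟩ h ⟨j, y⟩ h' hne
    obtain ⟨hi, hx⟩ := mem_product.1 h
    obtain ⟨hj, hy⟩ := mem_product.1 h'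
    obtain ⟨hxQ, hxf, hxE⟩ := hXmem x hx
    obtain ⟨hyQ, hyf, hyE⟩ := hXmem y hy
    by_cases hij : i = j
    · simp only at hi hj hx hy ⊢
      subst hij
      have hxy : x ≠ y := fun e => hne (by rw [e])
      rw [add_sub_add_left_eq_sub]
      refine le_trans ?_ (one_div_le_abs_sub hxy hxQ hyQ)
      refine one_div_le_one_div_of_le (by positivity) ?_
      have : Q * Q ≤ Q ^ 4 := by
        nlinarith [mul_nonneg (sq_nonneg Q) (by nlinarith : (0 : ℝ) ≤ Q ^ 2 - 1)]
      linarith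
    · exact hEsep i hi j hj hij _ _ hxQ hyQ hxE hyE x hxf y hyf

/-! ### Sums and products over primes, Rankin's trick -/

lemma inv_one_sub_le_exp {y : ℝ} (h0 : 0 ≤ y) (h1 : y ≤ 1 / 2) : (1 - y)⁻¹ ≤ Real.exp (2 * y) := by
  have hpos : 0 < 1 - y := by linarith
  refine le_trans ?_ (Real.add_one_le_exp (2 * y))
  rw [inv_le_iff_one_le_mul₀ hpos]
  nlinarith

/-- The coprime powers `p ^ ⌊n/p⌋` divide `n!`, which is at most `n ^ n`; and `n/p ≤ 2⌊n/p⌋` when `p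
≤ n`. -/
lemma sum_log_div_le {S : Finset ℕ} (hS : ∀ p ∈ S, p.Prime) {n : ℕ} (hn : ∀ p ∈ S, p ≤ n) :
    ∑ p ∈ S, Real.log p / p ≤ 2 * Real.log n := by
  rcases Nat.eq_zero_or_pos n with rfl | hpos
  · have : S = ∅ := by
      refine Finset.eq_empty_of_forall_notMem fun p hp => ?_
      have := (hS p hp).pos
      have := hn p hp
      omega
    simp [this]
  have hdvd : ∏ p ∈ S, p ^ (n / p) ∣ n.factorial := by
    refine Finset.prod_dvd_of_isRelPrime ?_ ?_
    · intro p hp q hq hpq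
      exact Nat.coprime_iff_isRelPrime.1
        (Nat.Coprime.pow _ _ ((Nat.coprime_primes (hS p hp) (hS q hq)).2 hpq))
    · intro p hp
      rw [(hS p hp).pow_dvd_factorial_iff (b := Nat.log p n + 2) (by omega)]
      have h1 : 1 ∈ Ico 1 (Nat.log p n + 2) := by simp
      simpa using Finset.single_le_sum (f := fun i => n / p ^ i) (fun _ _ => Nat.zero_le _) h1
  have hle : ∏ p ∈ S, p ^ (n / p) ≤ n ^ n :=
    (Nat.le_of_dvd n.factorial_pos hdvd).trans (Nat.factorial_le_pow n)
  have hlog : ∑ p ∈ S, ((n / p : ℕ) : ℝ) * Real.log p ≤ n * Real.log n := by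
    have h1 : ((∏ p ∈ S, p ^ (n / p) : ℕ) : ℝ) ≤ (n : ℝ) ^ n := by exact_mod_cast hle
    have h2 : (0 : ℝ) < ((∏ p ∈ S, p ^ (n / p) : ℕ) : ℝ) := by
      exact_mod_cast Finset.prod_pos fun p hp => pow_pos (hS p hp).pos _
    have h3 := Real.log_le_log h2 h1
    rw [Real.log_pow] at h3
    push_cast at h3
    rw [Real.log_prod (fun p hp => by
      have := (hS p hp).ne_zero
      positivity)] at h3
    simpa only [Real.log_pow] using h3
  have hn0 : (0 : ℝ) < n := by exact_mod_cast hpos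
  have hterm : ∀ p ∈ S, n * (Real.log p / p) ≤ 2 * (((n / p : ℕ) : ℝ) * Real.log p) := by
    intro p hp
    have hp0 : 0 < p := (hS p hp).pos
    have hp0' : (0 : ℝ) < p := by exact_mod_cast hp0
    have h1 : n ≤ 2 * (n / p) * p := by
      have h2 := Nat.div_add_mod n p
      have h3 := Nat.mod_lt n hp0
      have h4 : 1 ≤ n / p := (Nat.one_le_div_iff hp0).2 (hn p hp)
      nlinarith
    have h1' : (n : ℝ) ≤ 2 * ((n / p : ℕ) : ℝ) * p := by exact_mod_cast h1
    have h5 : (n : ℝ) / p ≤ 2 * ((n / p : ℕ) : ℝ) := by rwa [div_le_iff₀ hp0']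
    have h6 : 0 ≤ Real.log p := Real.log_natCast_nonneg p
    calc n * (Real.log p / p) = (n / p) * Real.log p := by ring
      _ ≤ 2 * ((n / p : ℕ) : ℝ) * Real.log p := by gcongr
      _ = _ := by ring
  have hfin : n * ∑ p ∈ S, Real.log p / p ≤ n * (2 * Real.log n) := by
    rw [Finset.mul_sum]
    calc _ ≤ ∑ p ∈ S, 2 * (((n / p : ℕ) : ℝ) * Real.log p) := Finset.sum_le_sum hterm
      _ ≤ _ := by rw [← Finset.mul_sum]; linarith
  exact le_of_mul_le_mul_left hfin hn0

/-- Primes up to `T` contribute at most `T`; beyond `T`, `1/p` is at most `log p / (p log T)`. Being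
weaker than Mertens' theorem does no harm: the coefficient `2 / log T` of `log n` can be made
arbitrarily small. -/
lemma sum_one_div_le {S : Finset ℕ} (hS : ∀ p ∈ S, p.Prime) {n : ℕ} (hn : ∀ p ∈ S, p ≤ n) {T : ℕ}
    (hT : 1 < T) : ∑ p ∈ S, 1 / (p : ℝ) ≤ T + 2 * Real.log n / Real.log T := by
  have hlogT : 0 < Real.log T := Real.log_pos (by exact_mod_cast hT)
  rw [← Finset.sum_filter_add_sum_filter_not S (fun p => p ≤ T)]
  gcongr
  · have h1 : ∑ p ∈ S with p ≤ T, 1 / (p : ℝ) ≤ ∑ p ∈ S with p ≤ T, (1 : ℝ) := by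
      refine Finset.sum_le_sum fun p hp => ?_
      have : (1 : ℝ) ≤ p := by exact_mod_cast (hS p (mem_filter.1 hp).1).one_le
      rw [div_le_one (by linarith)]; exact this
    refine h1.trans ?_
    rw [Finset.sum_const, nsmul_eq_mul, mul_one]
    have h2 : (S.filter fun p => p ≤ T) ⊆ Icc 1 T := by
      intro p hp
      obtain ⟨h, h'⟩ := mem_filter.1 hp
      exact mem_Icc.2 ⟨(hS p h).one_le, h'⟩
    have := Finset.card_le_card h2
    rw [Nat.card_Icc, Nat.add_sub_cancel] at this
    exact_mod_cast this
  · rw [le_div_iff₀ hlogT, Finset.sum_mul]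
    refine le_trans ?_ (sum_log_div_le hS hn)
    refine le_trans ?_ (Finset.sum_le_sum_of_subset_of_nonneg
      (Finset.filter_subset (fun p => ¬ p ≤ T) S) fun p _ _ => div_nonneg (Real.log_natCast_nonneg p) (Nat.cast_nonneg p))
    refine Finset.sum_le_sum fun p hp => ?_
    have h1 : T < p := not_le.1 (mem_filter.1 hp).2
    have h2 : Real.log T ≤ Real.log p := Real.log_le_log (by positivity) (by exact_mod_cast h1.le)
    rw [one_div_mul_eq_div]
    gcongr

/-- The Euler product over primes up to `n` expands into the sum of `1/m` over the smooth `m`, which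
include all `m ≤ n`, so it dominates the harmonic sum. -/
lemma log_le_prod_inv (n : ℕ) :
    Real.log (n + 1) ≤ ∏ p ∈ Nat.primesBelow (n + 1), (1 - 1 / (p : ℝ))⁻¹ := by
  let f : ℕ →* ℝ :=
    { toFun := fun n => (n : ℝ)⁻¹, map_one' := by simp, map_mul' := fun a b => by simp [mul_comm] }
  have hf : ∀ {p : ℕ}, p.Prime → ‖f p‖ < 1 := by
    intro p hp
    have : (1 : ℝ) < p := by exact_mod_cast hp.one_lt
    change ‖(p : ℝ)⁻¹‖ < 1
    rw [norm_inv, Real.norm_natCast]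
    exact inv_lt_one_of_one_lt₀ this
  have hs := (EulerProduct.summable_and_hasSum_smoothNumbers_prod_primesBelow_geometric hf (n + 1)).2
  have h1 : ∏ p ∈ Nat.primesBelow (n + 1), (1 - 1 / (p : ℝ))⁻¹ =
      ∏ p ∈ Nat.primesBelow (n + 1), (1 - f p)⁻¹ :=
    Finset.prod_congr rfl fun p _ => by rw [one_div]; rfl
  rw [h1]
  have h2 := log_add_one_le_harmonic n
  push_cast [harmonic] at h2
  refine h2.trans ?_
  have hinj : Set.InjOn (fun i : ℕ => i + 1) (range n) := fun a _ b _ h => by simpa using h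
  have hmem : ∀ i ∈ range n, i + 1 ∈ Nat.smoothNumbers (n + 1) := fun i hi =>
    Nat.mem_smoothNumbers_of_lt (Nat.succ_pos i) (by have := mem_range.1 hi; omega)
  have h3 : ∑ i ∈ range n, (((i + 1 : ℕ) : ℝ))⁻¹ =
      ∑ m ∈ ((range n).attach.image fun i : {i // i ∈ range n} =>
        (⟨i.1 + 1, hmem i.1 i.2⟩ : Nat.smoothNumbers (n + 1))), f m := by
    rw [Finset.sum_image, ← Finset.sum_attach]
    · rfl
    · intro a _ b _ h
      have := congrArg Subtype.val h
      exact Subtype.ext (by simpa using this)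
  have h4 : ∑ i ∈ range n, ((i : ℝ) + 1)⁻¹ = ∑ i ∈ range n, (((i + 1 : ℕ) : ℝ))⁻¹ := by
    push_cast; rfl
  rw [h4, h3]
  exact sum_le_hasSum _ (fun m _ => by change (0 : ℝ) ≤ (((m : ℕ) : ℝ))⁻¹; positivity) hs

/-- This is the price of discarding primes. Those above `r ^ 2` are at most `r ^ 2` in number and
add at most 1 to `∑ 1/p`; `sum_one_div_le` with `n = r ^ 2` handles the others. -/
lemma prod_inv_le_of_card {E : Finset ℕ} (hE : ∀ p ∈ E, p.Prime) {r : ℕ} (hr : 1 ≤ r)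
    (hcard : #E ≤ r ^ 2) {T : ℕ} (hT : 1 < T) :
    ∏ p ∈ E, (1 - 1 / (p : ℝ))⁻¹ ≤ Real.exp (2 + 2 * T) * (r : ℝ) ^ (8 / Real.log T) := by
  have hr0 : (0 : ℝ) < r := by exact_mod_cast hr
  have h1 : ∏ p ∈ E, (1 - 1 / (p : ℝ))⁻¹ ≤ Real.exp (2 * ∑ p ∈ E, 1 / (p : ℝ)) := by
    rw [Finset.mul_sum, Real.exp_sum]
    have hhalf : ∀ p ∈ E, 1 / (p : ℝ) ≤ 1 / 2 := fun p hp => by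
      have : (2 : ℝ) ≤ p := by exact_mod_cast (hE p hp).two_le
      gcongr
    exact Finset.prod_le_prod
      (fun p hp => inv_nonneg.2 (by linarith [hhalf p hp]))
      fun p hp => inv_one_sub_le_exp (by positivity) (hhalf p hp)
  refine h1.trans ?_
  rw [Real.rpow_def_of_pos hr0, ← Real.exp_add]
  refine Real.exp_le_exp.2 ?_
  have h2 : ∑ p ∈ E, 1 / (p : ℝ) ≤ (T + 2 * Real.log ((r ^ 2 : ℕ) : ℝ) / Real.log T) + 1 := by
    rw [← Finset.sum_filter_add_sum_filter_not E (fun p => p ≤ r ^ 2)]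
    gcongr
    · exact sum_one_div_le (fun p hp => hE p (mem_filter.1 hp).1) (fun p hp => (mem_filter.1 hp).2) hT
    · have h3 : ∑ p ∈ E with ¬ p ≤ r ^ 2, 1 / (p : ℝ) ≤
          ∑ p ∈ E with ¬ p ≤ r ^ 2, 1 / ((r : ℝ) ^ 2) := by
        refine Finset.sum_le_sum fun p hp => ?_
        have : r ^ 2 ≤ p := (not_le.1 (mem_filter.1 hp).2).le
        have : (r : ℝ) ^ 2 ≤ p := by exact_mod_cast this
        gcongr
      refine h3.trans ?_
      rw [Finset.sum_const, nsmul_eq_mul, mul_one_div, div_le_one (by positivity)]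
      exact_mod_cast (Finset.card_le_card (Finset.filter_subset _ _)).trans hcard
  have h5 : Real.log ((r ^ 2 : ℕ) : ℝ) = 2 * Real.log r := by push_cast; rw [Real.log_pow]; norm_num
  rw [h5] at h2
  calc _ ≤ 2 * ((T + 2 * (2 * Real.log r) / Real.log T) + 1) := by gcongr
    _ = _ := by ring

/-- Rankin's trick: the sieve sum truncated at `z ^ (4k + 1)` is at least half of the full one. -/
lemma half_prod_inv_le {P : Finset ℕ} (hP : ∀ p ∈ P, p.Prime) {z : ℝ} (hz : 1 < z)
    (hPz : ∀ p ∈ P, (p : ℝ) ≤ z) {k : ℕ} {g : ℕ → ℝ} (hg0 : ∀ p ∈ P, 0 < g p)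
    (hg1 : ∀ p ∈ P, g p ≤ 1) (hgk : ∀ p ∈ P, 1 - g p ≤ k / p) :
    1 / 2 * ∏ p ∈ P, (g p)⁻¹ ≤
      ∑ S ∈ P.powerset with ((∏ p ∈ S, p : ℕ) : ℝ) ≤ z ^ (4 * k + 1), ∏ p ∈ S, ((g p)⁻¹ - 1) := by
  set Q := z ^ (4 * k + 1) with hQ
  have hlz : 0 < Real.log z := Real.log_pos hz
  set J : ℕ → ℝ := fun p => (g p)⁻¹ - 1 with hJ
  -- Rankin's weight is `p ^ (1 / log z)`: its product over `S` exceeds `exp (4k + 1)` whenever the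
  -- product of `S` exceeds `Q`.
  set w : ℕ → ℝ := fun p => Real.exp (Real.log p / Real.log z) with hw
  have hJ0 : ∀ p ∈ P, 0 ≤ J p := fun p hp => by
    have := (one_le_inv₀ (hg0 p hp)).2 (hg1 p hp)
    simp only [hJ]; linarith
  have hfull : ∑ S ∈ P.powerset, ∏ p ∈ S, J p = ∏ p ∈ P, (g p)⁻¹ := by
    rw [← Finset.prod_one_add]
    exact Finset.prod_congr rfl fun p _ => by simp only [hJ]; ring
  have hbad : Real.exp (4 * k + 1) *
      ∑ S ∈ P.powerset with ¬ ((∏ p ∈ S, p : ℕ) : ℝ) ≤ Q, ∏ p ∈ S, J p ≤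
      ∏ p ∈ P, (1 + J p * w p) := by
    rw [Finset.prod_one_add, Finset.mul_sum]
    have hJS : ∀ S ∈ P.powerset, ∀ p ∈ S, 0 ≤ J p := fun S hS p hp => hJ0 p (mem_powerset.1 hS hp)
    refine le_trans (Finset.sum_le_sum (g := fun S => ∏ p ∈ S, J p * w p) fun S hS => ?_)
      (Finset.sum_le_sum_of_subset_of_nonneg (Finset.filter_subset _ _) fun S hS _ =>
        Finset.prod_nonneg fun p hp => mul_nonneg (hJS S hS p hp) (Real.exp_pos _).le)
    obtain ⟨hSP, hSQ⟩ := mem_filter.1 hS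
    rw [Finset.prod_mul_distrib, mul_comm]
    refine mul_le_mul_of_nonneg_left ?_ (Finset.prod_nonneg fun p hp => hJS S hSP p hp)
    simp only [hw]
    rw [← Real.exp_sum]
    refine Real.exp_le_exp.2 ?_
    rw [← Finset.sum_div, le_div_iff₀ hlz]
    have h1 := Real.log_le_log (by positivity) (not_le.1 hSQ).le
    rw [hQ, Real.log_pow] at h1
    push_cast at h1
    rwa [Real.log_prod (fun p hp => by
      have := (hP p (mem_powerset.1 hSP hp)).ne_zero
      positivity)] at h1
  -- The weights cost at most `exp (4k)`, where 4 is the product of the 2 in `w p - 1 ≤ 2 log p /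
  -- log z` and the 2 in `∑ log p / p ≤ 2 log z`. The spare 1 in the exponent makes the tail at most
  -- `1/e`, hence at most half, of the full sum.
  have hprod : ∏ p ∈ P, (1 + J p * w p) ≤ (∏ p ∈ P, (g p)⁻¹) * Real.exp (4 * k) := by
    have h1 : ∀ p ∈ P, 1 + J p * w p ≤
        (g p)⁻¹ * Real.exp (k * (2 / Real.log z) * (Real.log p / p)) := by
      intro p hp
      have hp0 : (0 : ℝ) < p := by exact_mod_cast (hP p hp).pos
      have hp1 : (1 : ℝ) ≤ p := by exact_mod_cast (hP p hp).one_le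
      have hlp : 0 ≤ Real.log p := Real.log_nonneg hp1
      have hu0 : 0 ≤ Real.log p / Real.log z := by positivity
      have hu1 : Real.log p / Real.log z ≤ 1 := by
        rw [div_le_one hlz]; exact Real.log_le_log hp0 (hPz p hp)
      have hw1 : w p - 1 ≤ 2 * (Real.log p / Real.log z) := by
        have := Real.abs_exp_sub_one_le (x := Real.log p / Real.log z) (by rwa [abs_of_nonneg hu0])
        rw [abs_of_nonneg hu0] at this
        exact (le_abs_self _).trans this
      have hw0 : 0 ≤ w p - 1 := by
        have := Real.add_one_le_exp (Real.log p / Real.log z)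
        simp only [hw]; linarith
      have e : 1 + J p * w p = (g p)⁻¹ * (1 + (1 - g p) * (w p - 1)) := by
        have := (hg0 p hp).ne'
        simp only [hJ]; field_simp; ring
      rw [e]
      refine mul_le_mul_of_nonneg_left ?_ (inv_nonneg.2 (hg0 p hp).le)
      refine le_trans ?_ ((add_comm _ _).le.trans (Real.add_one_le_exp _))
      have h3 : (1 - g p) * (w p - 1) ≤ (k / p) * (2 * (Real.log p / Real.log z)) :=
        mul_le_mul (hgk p hp) hw1 hw0 (by positivity)
      have h4 : (k / p) * (2 * (Real.log p / Real.log z)) =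
        k * (2 / Real.log z) * (Real.log p / p) := by ring
      linarith
    refine (Finset.prod_le_prod (fun p hp => ?_) h1).trans ?_
    · have := mul_nonneg (hJ0 p hp) (Real.exp_pos (Real.log p / Real.log z)).le
      linarith
    rw [Finset.prod_mul_distrib, ← Real.exp_sum, ← Finset.mul_sum]
    have hprod0 : 0 ≤ ∏ p ∈ P, (g p)⁻¹ := Finset.prod_nonneg fun p hp => inv_nonneg.2 (hg0 p hp).le
    refine mul_le_mul_of_nonneg_left (Real.exp_le_exp.2 ?_) hprod0
    have h2 : ∑ p ∈ P, Real.log p / p ≤ 2 * Real.log z := by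
      refine (sum_log_div_le hP (n := ⌊z⌋₊) fun p hp => Nat.le_floor (hPz p hp)).trans ?_
      have hfl : 1 ≤ ⌊z⌋₊ := Nat.le_floor (by exact_mod_cast hz.le)
      have := Real.log_le_log (by exact_mod_cast hfl) (Nat.floor_le (by linarith : 0 ≤ z))
      linarith
    calc k * (2 / Real.log z) * ∑ p ∈ P, Real.log p / p
        ≤ k * (2 / Real.log z) * (2 * Real.log z) := by gcongr
      _ = 4 * k := by field_simp; ring
  have hsplit := Finset.sum_filter_add_sum_filter_not P.powerset
    (fun S => ((∏ p ∈ S, p : ℕ) : ℝ) ≤ Q) (fun S => ∏ p ∈ S, J p)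
  rw [hfull] at hsplit
  set B := ∑ S ∈ P.powerset with ¬ ((∏ p ∈ S, p : ℕ) : ℝ) ≤ Q, ∏ p ∈ S, J p with hB
  have h3 : Real.exp 1 * B ≤ ∏ p ∈ P, (g p)⁻¹ := by
    have h4 := hbad.trans hprod
    rw [Real.exp_add, mul_comm _ (Real.exp (4 * k)), mul_assoc] at h4
    exact le_of_mul_le_mul_left h4 (Real.exp_pos _)
  have hB0 : 0 ≤ B := Finset.sum_nonneg fun S hS => Finset.prod_nonneg fun p hp =>
    hJ0 p (mem_powerset.1 (mem_filter.1 hS).1 hp)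
  have h5 : 2 * B ≤ Real.exp 1 * B := by
    gcongr
    linarith [Real.add_one_le_exp (1 : ℝ)]
  linarith

/-! ### Local factors and the singular series -/

/-- Bernoulli's inequality gives `1 + kx ≤ (1 + x) ^ k`, and `(1 - x²) ^ k ≤ 1`. -/
lemma one_sub_sq_le_div_pow {k : ℕ} {x : ℝ} (hx0 : 0 ≤ x) (hx1 : x < 1) (hkx : k * x ≤ 1) :
    1 - (k * x) ^ 2 ≤ (1 - k * x) / (1 - x) ^ k := by
  rw [le_div_iff₀ (pow_pos (by linarith) k)]
  have h1 : 1 + k * x ≤ (1 + x) ^ k := one_add_mul_le_pow (by linarith) k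
  have h2 : (1 - x) ^ k * (1 + k * x) ≤ 1 := by
    calc (1 - x) ^ k * (1 + k * x) ≤ (1 - x) ^ k * (1 + x) ^ k := by
          gcongr
      _ = (1 - x ^ 2) ^ k := by rw [← mul_pow]; ring
      _ ≤ 1 := pow_le_one₀ (by nlinarith) (by nlinarith)
  calc (1 - (k * x) ^ 2) * (1 - x) ^ k = (1 - k * x) * ((1 - x) ^ k * (1 + k * x)) := by ring
    _ ≤ (1 - k * x) * 1 := by gcongr
    _ = _ := mul_one _

/-- The reciprocal of a lower bound for the finite partial products of the singular series. -/
def partialProductBound (k : ℕ) : ℕ := (2 * k) ^ (2 * k) * 3 ^ (2 * k ^ 2)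

lemma sum_inv_sq_le_one {T : Finset ℕ} (hT : ∀ n ∈ T, 2 ≤ n) : ∑ n ∈ T, ((n : ℝ) ^ 2)⁻¹ ≤ 1 := by
  obtain ⟨m, hm⟩ := T.exists_nat_subset_range
  have h1 : T ⊆ Ioc 1 (m + 1) := fun n hn => by
    have := mem_range.1 (hm hn)
    have := hT n hn
    rw [mem_Ioc]; omega
  refine (Finset.sum_le_sum_of_subset_of_nonneg h1 fun _ _ _ => by positivity).trans ?_
  refine (sum_Ioc_inv_sq_le_sub one_ne_zero (by omega)).trans ?_
  have : (0 : ℝ) ≤ ((m + 1 : ℕ) : ℝ)⁻¹ := by positivity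
  rw [Nat.cast_one, inv_one]; linarith

/-- The fewer than `2k` primes below `2k` contribute at least `1/(2k)` each. A larger prime
contributes at least `1 - (k/p)² ≥ exp (-2k²/p²)`, and `∑ 1/p² ≤ 1`. No upper bound on the factors
is needed, so primes dividing the discriminant do no harm. -/
lemma inv_partialProductBound_le_prod {k : ℕ} (hk : 1 ≤ k) {T : Finset ℕ} (hT : ∀ p ∈ T, p.Prime)
    {g : ℕ → ℝ} (hg0 : ∀ p ∈ T, 1 / (p : ℝ) ≤ g p) (hgk : ∀ p ∈ T, 1 - g p ≤ k / p) :
    ((partialProductBound k : ℕ) : ℝ)⁻¹ ≤ ∏ p ∈ T, g p / (1 - 1 / (p : ℝ)) ^ k := by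
  have hk0 : (1 : ℝ) ≤ k := by exact_mod_cast hk
  rw [← Finset.prod_filter_mul_prod_filter_not T (fun p => p < 2 * k), partialProductBound]
  push_cast
  rw [mul_inv]
  have hp2 : ∀ p ∈ T, (2 : ℝ) ≤ p := fun p hp => by exact_mod_cast (hT p hp).two_le
  have hinv : ∀ p ∈ T, 1 / (p : ℝ) ≤ 1 / 2 := fun p hp => by have := hp2 p hp; gcongr
  have hsmall : ((2 * (k : ℝ)) ^ (2 * k))⁻¹ ≤
      ∏ p ∈ T with p < 2 * k, g p / (1 - 1 / (p : ℝ)) ^ k := by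
    have h1 : ∏ p ∈ T with p < 2 * k, (2 * (k : ℝ))⁻¹ ≤
        ∏ p ∈ T with p < 2 * k, g p / (1 - 1 / (p : ℝ)) ^ k := by
      refine Finset.prod_le_prod (fun _ _ => by positivity) fun p hp => ?_
      obtain ⟨hpT, hpk⟩ := mem_filter.1 hp
      have h2 := hp2 p hpT
      have h3 : (p : ℝ) ≤ 2 * k := by exact_mod_cast hpk.le
      have h5 : 0 < 1 - 1 / (p : ℝ) := by linarith [hinv p hpT]
      have h6 : (1 - 1 / (p : ℝ)) ^ k ≤ 1 :=
        pow_le_one₀ h5.le (by have : (0 : ℝ) ≤ 1 / p := by positivity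
                              linarith)
      rw [le_div_iff₀ (pow_pos h5 k)]
      calc (2 * (k : ℝ))⁻¹ * (1 - 1 / (p : ℝ)) ^ k ≤ (2 * (k : ℝ))⁻¹ * 1 := by gcongr
        _ ≤ 1 / p := by rw [mul_one, ← one_div]; gcongr
        _ ≤ g p := hg0 p hpT
    refine le_trans ?_ h1
    rw [Finset.prod_const, ← inv_pow]
    refine pow_le_pow_of_le_one (by positivity) (inv_le_one_of_one_le₀ (by linarith)) ?_
    have h2 : (T.filter fun p => p < 2 * k) ⊆ range (2 * k) := fun p hp =>
      mem_range.2 (mem_filter.1 hp).2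
    simpa using Finset.card_le_card h2
  have hlarge : ((3 : ℝ) ^ (2 * k ^ 2))⁻¹ ≤
      ∏ p ∈ T with ¬ p < 2 * k, g p / (1 - 1 / (p : ℝ)) ^ k := by
    have h1 : ∏ p ∈ T with ¬ p < 2 * k, Real.exp (-(2 * k ^ 2 * ((p : ℝ) ^ 2)⁻¹)) ≤
        ∏ p ∈ T with ¬ p < 2 * k, g p / (1 - 1 / (p : ℝ)) ^ k := by
      refine Finset.prod_le_prod (fun _ _ => (Real.exp_pos _).le) fun p hp => ?_
      obtain ⟨hpT, hpk⟩ := mem_filter.1 hp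
      have h2 := hp2 p hpT
      have h3 : 2 * (k : ℝ) ≤ p := by exact_mod_cast not_lt.1 hpk
      have h4 : k * (1 / (p : ℝ)) ≤ 1 / 2 := by
        rw [mul_one_div, div_le_iff₀ (by linarith)]; linarith
      have h4' : 0 ≤ k * (1 / (p : ℝ)) := by positivity
      have h5 : 0 < 1 - 1 / (p : ℝ) := by linarith [hinv p hpT]
      have h6 := one_sub_sq_le_div_pow (k := k) (x := 1 / (p : ℝ)) (by positivity) (by linarith)
        (by linarith)
      have h7 : (1 - k * (1 / (p : ℝ))) / (1 - 1 / (p : ℝ)) ^ k ≤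
          g p / (1 - 1 / (p : ℝ)) ^ k := by
        gcongr
        have := hgk p hpT
        rw [mul_one_div]; linarith
      have h8 : (k * (1 / (p : ℝ))) ^ 2 ≤ 1 / 2 := by nlinarith
      have h9 := inv_one_sub_le_exp (sq_nonneg (k * (1 / (p : ℝ)))) h8
      have h10 : Real.exp (-(2 * (k * (1 / (p : ℝ))) ^ 2)) ≤ 1 - (k * (1 / (p : ℝ))) ^ 2 := by
        rw [Real.exp_neg]
        exact inv_le_of_inv_le₀ (by linarith) h9
      have e : 2 * (k : ℝ) ^ 2 * ((p : ℝ) ^ 2)⁻¹ = 2 * (k * (1 / (p : ℝ))) ^ 2 := by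
        field_simp
      rw [e]
      linarith
    refine le_trans ?_ h1
    rw [← Real.exp_sum, Finset.sum_neg_distrib, ← Finset.mul_sum, Real.exp_neg]
    refine inv_anti₀ (Real.exp_pos _) ?_
    have h2 := sum_inv_sq_le_one (T := T.filter fun p => ¬ p < 2 * k)
      fun p hp => (hT p (mem_filter.1 hp).1).two_le
    calc Real.exp (2 * k ^ 2 * ∑ p ∈ T with ¬ p < 2 * k, ((p : ℝ) ^ 2)⁻¹)
        ≤ Real.exp (2 * k ^ 2 * 1) := by gcongr
      _ = Real.exp 1 ^ (2 * k ^ 2) := by rw [← Real.exp_nat_mul]; push_cast; ring_nf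
      _ ≤ 3 ^ (2 * k ^ 2) := by
          gcongr
          linarith [Real.exp_one_lt_d9]
  exact mul_le_mul hsmall hlarge (by positivity) (le_trans (by positivity) hsmall)

variable {k : ℕ}

/-- The residues modulo `q` at which the product of the forms is coprime to `q`. -/
def coprimeResidues (a b : Fin k → ℤ) (q : ℕ) : Finset ℕ :=
  (range q).filter fun n : ℕ => Int.gcd (q : ℤ) (formProd a b n) = 1

lemma gamma_eq (a b : Fin k → ℤ) (q : ℕ) : gamma a b q = (#(coprimeResidues a b q) : ℝ) / q := rfl

lemma coprimeResidues_nonempty {a b : Fin k → ℤ} (h : NonDegenerate a b) {q : ℕ} (hq : 1 ≤ q) :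
    (coprimeResidues a b q).Nonempty := by
  by_contra hne
  have := h q hq
  rw [gamma_eq, Finset.not_nonempty_iff_eq_empty.1 hne] at this
  simp at this

lemma one_div_le_gamma {a b : Fin k → ℤ} (h : NonDegenerate a b) {q : ℕ} (hq : 1 ≤ q) :
    1 / (q : ℝ) ≤ gamma a b q := by
  rw [gamma_eq]
  gcongr
  exact_mod_cast Finset.card_pos.2 (coprimeResidues_nonempty h hq)

lemma gamma_le_one (a b : Fin k → ℤ) (q : ℕ) : gamma a b q ≤ 1 := by
  rw [gamma_eq]
  refine div_le_one_of_le₀ ?_ (Nat.cast_nonneg q)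
  have := Finset.card_filter_le (range q) fun n : ℕ => Int.gcd (q : ℤ) (formProd a b n) = 1
  rw [card_range] at this
  exact_mod_cast this

lemma gcd_ne_one_iff {p : ℕ} (hp : p.Prime) (m : ℤ) : ¬ Int.gcd (p : ℤ) m = 1 ↔ (p : ℤ) ∣ m := by
  rw [← Int.isCoprime_iff_gcd_eq_one, (Nat.prime_iff_prime_int.1 hp).coprime_iff_not_dvd, not_not]

lemma one_sub_gamma_eq (a b : Fin k → ℤ) {p : ℕ} (hp : p.Prime) :
    1 - gamma a b p = #((range p).filter fun n : ℕ => (p : ℤ) ∣ formProd a b n) / p := by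
  have hp0 : (p : ℝ) ≠ 0 := by exact_mod_cast hp.ne_zero
  have h1 := Finset.card_filter_add_card_filter_not (s := range p)
    (fun n : ℕ => Int.gcd (p : ℤ) (formProd a b n) = 1)
  simp_rw [gcd_ne_one_iff hp] at h1
  rw [card_range] at h1
  have h2 : (#(coprimeResidues a b p) : ℝ) +
      #((range p).filter fun n : ℕ => (p : ℤ) ∣ formProd a b n) = p := by exact_mod_cast h1
  rw [gamma_eq, eq_div_iff hp0, sub_mul, div_mul_cancel₀ _ hp0]; linarith

lemma dvd_formProd_iff (a b : Fin k → ℤ) {p : ℕ} (hp : p.Prime) (n : ℤ) :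
    (p : ℤ) ∣ formProd a b n ↔ ∃ j, (p : ℤ) ∣ a j * n + b j := by
  rw [formProd, (Nat.prime_iff_prime_int.1 hp).dvd_finsetProd_iff]; simp

lemma eq_of_dvd_sub {p m n : ℕ} (hm : m < p) (hn : n < p) (h : (p : ℤ) ∣ (m : ℤ) - n) : m = n := by
  have := Int.eq_zero_of_abs_lt_dvd h (by rw [abs_lt]; constructor <;> omega)
  omega

/-- Non-degeneracy at `p` prevents any form from vanishing identically modulo `p`, so each form has
at most one root there. -/
lemma one_sub_gamma_le {a b : Fin k → ℤ} (h : NonDegenerate a b) {p : ℕ} (hp : p.Prime) :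
    1 - gamma a b p ≤ k / p := by
  rw [one_sub_gamma_eq a b hp]
  gcongr
  have hsub : ((range p).filter fun n : ℕ => (p : ℤ) ∣ formProd a b n) ⊆
      (univ : Finset (Fin k)).biUnion fun j =>
        (range p).filter fun n : ℕ => (p : ℤ) ∣ a j * n + b j := by
    intro n hn
    obtain ⟨h1, h2⟩ := mem_filter.1 hn
    obtain ⟨j, hj⟩ := (dvd_formProd_iff a b hp n).1 h2
    exact mem_biUnion.2 ⟨j, mem_univ _, mem_filter.2 ⟨h1, hj⟩⟩
  refine (Finset.card_le_card hsub).trans ?_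
  refine (Finset.card_biUnion_le_card_mul _ _ 1 fun j _ => ?_).trans (by simp)
  refine Finset.card_le_one.2 fun m hm n hn => ?_
  obtain ⟨hm1, hm2⟩ := mem_filter.1 hm
  obtain ⟨hn1, hn2⟩ := mem_filter.1 hn
  refine eq_of_dvd_sub (mem_range.1 hm1) (mem_range.1 hn1) ?_
  have h1 : (p : ℤ) ∣ a j * ((m : ℤ) - n) := by
    have := dvd_sub hm2 hn2
    rwa [show a j * (m : ℤ) + b j - (a j * n + b j) = a j * ((m : ℤ) - n) by ring] at this
  rcases (Nat.prime_iff_prime_int.1 hp).dvd_or_dvd h1 with h2 | h2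
  · exfalso
    have hb : (p : ℤ) ∣ b j := (dvd_add_right (h2.mul_right (m : ℤ))).1 hm2
    obtain ⟨l, hl⟩ := coprimeResidues_nonempty h hp.one_le
    have h3 := (mem_filter.1 hl).2
    refine (gcd_ne_one_iff hp _).2 ?_ h3
    exact (dvd_formProd_iff a b hp l).2 ⟨j, dvd_add (h2.mul_right _) hb⟩
  · exact h2

lemma exists_root {p : ℕ} (hp : p.Prime) {α β : ℤ} (hα : ¬ (p : ℤ) ∣ α) :
    ∃ n : ℕ, n < p ∧ (p : ℤ) ∣ α * n + β := by
  have := Fact.mk hp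
  have h0 : (α : ZMod p) ≠ 0 := by rwa [Ne, ZMod.intCast_zmod_eq_zero_iff_dvd]
  refine ⟨(-(β : ZMod p) / α).val, ZMod.val_lt _, ?_⟩
  rw [← ZMod.intCast_zmod_eq_zero_iff_dvd]
  push_cast
  rw [ZMod.natCast_zmod_val]
  field_simp; ring

/-- Each form has a root modulo `p`, and a root common to two forms would make `p` divide their
factor of the discriminant. -/
lemma one_sub_gamma_ge {a b : Fin k → ℤ} {p : ℕ} (hp : p.Prime) (ha : ∀ j, ¬ (p : ℤ) ∣ a j)
    (hd : ¬ (p : ℤ) ∣ discriminant a b) : k / p ≤ 1 - gamma a b p := by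
  rw [one_sub_gamma_eq a b hp]
  gcongr
  choose r hr hrd using fun j => exists_root hp (β := b j) (ha j)
  have hlt : ∀ i j, i < j → r i ≠ r j := by
    intro i j hij e
    refine hd ?_
    have h1 : (p : ℤ) ∣ a i * b j - a j * b i := by
      have h2 := dvd_sub ((hrd j).mul_left (a i)) ((hrd i).mul_left (a j))
      rw [e] at h2
      rwa [show a i * (a j * (r j : ℤ) + b j) - a j * (a i * (r j : ℤ) + b i) =
        a i * b j - a j * b i by ring] at h2
    exact h1.trans ((Finset.dvd_prod_of_mem (fun j => a i * b j - a j * b i)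
      (mem_Ioi.2 hij)).trans
        (Finset.dvd_prod_of_mem (fun i => ∏ j ∈ Ioi i, (a i * b j - a j * b i)) (mem_univ i)))
  have hinj : Function.Injective r := by
    intro i j e
    by_contra hne
    rcases lt_or_gt_of_ne hne with h | h
    · exact hlt i j h e
    · exact hlt j i h e.symm
  have hle := Finset.card_le_card (s := univ.image r)
    (t := (range p).filter fun n : ℕ => (p : ℤ) ∣ formProd a b n) (by
      intro n hn
      obtain ⟨j, _, rfl⟩ := mem_image.1 hn
      exact mem_filter.2 ⟨mem_range.2 (hr j), (dvd_formProd_iff a b hp _).2 ⟨j, hrd j⟩⟩)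
  rwa [Finset.card_image_of_injective _ hinj, card_univ, Fintype.card_fin] at hle

/-- For all but finitely many primes `γ(p) = 1 - k/p` exactly, so the local factor differs from 1 by
at most `k²/p²`. -/
lemma multipliable_localFactor {a b : Fin k → ℤ} (ha : ∀ j, a j ≠ 0) (hd : discriminant a b ≠ 0)
    (h : NonDegenerate a b) : Multipliable (localFactor a b) := by
  have hsum : Summable fun p : Nat.Primes => localFactor a b p - 1 := by
    have hbig : Summable fun p : Nat.Primes => (k : ℝ) ^ 2 * (1 / ((p : ℕ) : ℝ) ^ 2) :=
      ((Real.summable_one_div_nat_pow.2 one_lt_two).comp_injective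
        (i := fun p : Nat.Primes => (p : ℕ)) Subtype.coe_injective).mul_left _
    refine hbig.of_norm_bounded_eventually ?_
    set m : ℕ := (discriminant a b * ∏ j, a j).natAbs + k with hm
    have hfin : {p : Nat.Primes | (p : ℕ) ≤ m}.Finite :=
      (Set.finite_Iic m).preimage (f := fun p : Nat.Primes => (p : ℕ))
        Subtype.coe_injective.injOn
    filter_upwards [hfin.compl_mem_cofinite] with p hp
    have hpm : m < (p : ℕ) := not_le.1 hp
    have hpp : (p : ℕ).Prime := p.2
    have hndvd : ¬ (((p : ℕ) : ℤ) ∣ discriminant a b * ∏ j, a j) := by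
      intro hdvd
      have h0 : (discriminant a b * ∏ j, a j).natAbs ≠ 0 :=
        Int.natAbs_ne_zero.2 (mul_ne_zero hd (Finset.prod_ne_zero_iff.2 fun j _ => ha j))
      have := Nat.le_of_dvd (Nat.pos_of_ne_zero h0) (Int.natCast_dvd.1 hdvd)
      omega
    have hγ : 1 - gamma a b p = k / p :=
      le_antisymm (one_sub_gamma_le h hpp) (one_sub_gamma_ge hpp
        (fun j hj => hndvd ((hj.trans (Finset.dvd_prod_of_mem a (mem_univ j))).mul_left _))
        fun hj => hndvd (hj.mul_right _))
    have hp2 : (2 : ℝ) ≤ ((p : ℕ) : ℝ) := by exact_mod_cast hpp.two_le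
    have hkp : (k : ℝ) ≤ ((p : ℕ) : ℝ) := by exact_mod_cast (by omega : k ≤ (p : ℕ))
    have hx1 : 1 / ((p : ℕ) : ℝ) ≤ 1 / 2 := by gcongr
    have hloc : localFactor a b p =
        (1 - k * (1 / ((p : ℕ) : ℝ))) / (1 - 1 / ((p : ℕ) : ℝ)) ^ k := by
      rw [localFactor]; congr 1; rw [mul_one_div]; linarith
    have hlow := one_sub_sq_le_div_pow (k := k) (x := 1 / ((p : ℕ) : ℝ)) (by positivity)
      (by linarith) (by rw [mul_one_div, div_le_one (by linarith)]; exact hkp)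
    have hup : (1 - k * (1 / ((p : ℕ) : ℝ))) / (1 - 1 / ((p : ℕ) : ℝ)) ^ k ≤ 1 := by
      have hpos : 0 < (1 - 1 / ((p : ℕ) : ℝ)) ^ k := pow_pos (by linarith) k
      rw [div_le_one hpos]
      have := one_add_mul_le_pow (a := -(1 / ((p : ℕ) : ℝ))) (by linarith) k
      rw [← sub_eq_add_neg] at this
      linarith
    rw [Real.norm_eq_abs, abs_of_nonpos (by rw [hloc]; linarith), hloc]
    have e : (k : ℝ) ^ 2 * (1 / ((p : ℕ) : ℝ) ^ 2) = (k * (1 / ((p : ℕ) : ℝ))) ^ 2 := by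
      rw [mul_pow, one_div_pow]
    rw [e]; linarith
  have := Real.multipliable_one_add_of_summable hsum
  simpa using this

/-- Any finite product containing `P` is the product over `P` times a complementary product, which
is bounded below in terms of `k` alone; then pass to the limit. -/
lemma prod_localFactor_le {a b : Fin k → ℤ} (hk : 1 ≤ k) (hmul : Multipliable (localFactor a b))
    (h : NonDegenerate a b) {P : Finset ℕ} (hP : ∀ p ∈ P, p.Prime) :
    ∏ p ∈ P, gamma a b p / (1 - 1 / (p : ℝ)) ^ k ≤ partialProductBound k * singularSeries a b := by
  set ℓ : ℕ → ℝ := fun p => gamma a b p / (1 - 1 / (p : ℝ)) ^ k with hℓ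
  have hlower : ∀ T : Finset ℕ, (∀ p ∈ T, p.Prime) →
      ((partialProductBound k : ℕ) : ℝ)⁻¹ ≤ ∏ p ∈ T, ℓ p := fun T hT =>
    inv_partialProductBound_le_prod hk hT (fun p hp => one_div_le_gamma h (hT p hp).one_le)
      fun p hp => one_sub_gamma_le h (hT p hp)
  have hc : (0 : ℝ) < (partialProductBound k : ℕ) := by
    have : 0 < 2 * k := by omega
    unfold partialProductBound
    exact_mod_cast Nat.mul_pos (pow_pos this _) (pow_pos three_pos _)
  have hmain : ((partialProductBound k : ℕ) : ℝ)⁻¹ * ∏ p ∈ P, ℓ p ≤ singularSeries a b := by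
    refine ge_of_tendsto hmul.hasProd ?_
    filter_upwards [Filter.eventually_ge_atTop (P.subtype Nat.Prime)] with U hU
    have h1 : ∏ p ∈ U, localFactor a b p =
        ∏ p ∈ U.map (Function.Embedding.subtype Nat.Prime), ℓ p :=
      (Finset.prod_map (s := (U : Finset (Subtype Nat.Prime)))
        (e := Function.Embedding.subtype Nat.Prime) (f := ℓ)).symm
    have hsub : P ⊆ U.map (Function.Embedding.subtype Nat.Prime) := by
      intro p hp
      refine mem_map.2 ⟨⟨p, hP p hp⟩, hU (mem_subtype.2 hp), rfl⟩
    rw [h1, ← Finset.prod_sdiff hsub]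
    refine mul_le_mul_of_nonneg_right (hlower _ fun p hp => ?_)
      (le_trans (by positivity) (hlower P hP))
    obtain ⟨q, _, rfl⟩ := mem_map.1 (mem_sdiff.1 hp).1
    exact q.2
  rwa [inv_mul_le_iff₀ hc] at hmain

lemma partialProductBound_pos (hk : 1 ≤ k) : (0 : ℝ) < (partialProductBound k : ℕ) := by
  have : 0 < 2 * k := by omega
  unfold partialProductBound
  exact_mod_cast Nat.mul_pos (pow_pos this _) (pow_pos three_pos _)

lemma one_le_mul_singularSeries {a b : Fin k → ℤ} (hk : 1 ≤ k)
    (hmul : Multipliable (localFactor a b)) (h : NonDegenerate a b) :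
    1 ≤ partialProductBound k * singularSeries a b := by
  simpa using prod_localFactor_le hk hmul h (P := ∅) (by simp)

lemma singularSeries_pos {a b : Fin k → ℤ} (hk : 1 ≤ k)
    (hmul : Multipliable (localFactor a b)) (h : NonDegenerate a b) : 0 < singularSeries a b :=
  pos_of_mul_pos_right (one_pos.trans_le (one_le_mul_singularSeries hk hmul h))
    (partialProductBound_pos hk).le

/-! ### The sieve bound at separated points -/

/-- The constant of the sieve bound `sum_norm_sq_expPoly_le_card`. -/
def sieveConst (k T : ℕ) : ℕ :=
  96 * partialProductBound k * (4 * (4 * k + 1)) ^ k * 3 ^ ((2 + 2 * T) * k)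

lemma prod_gamma_sdiff_le {a b : Fin k → ℤ} (hk : 1 ≤ k)
    (hmul : Multipliable (localFactor a b)) (h : NonDegenerate a b) {z : ℝ} (hz : 1 < z)
    {E : Finset ℕ} {r : ℕ} (hr : 1 ≤ r) (hE : #E ≤ r ^ 2) {T : ℕ} (hT : 1 < T) :
    ∏ p ∈ Nat.primesBelow (⌊z⌋₊ + 1) \ E, gamma a b p ≤
      partialProductBound k * singularSeries a b *
        ((Real.log z)⁻¹ * (Real.exp (2 + 2 * T) * (r : ℝ) ^ (8 / Real.log T))) ^ k := by
  set P := Nat.primesBelow (⌊z⌋₊ + 1) with hPdef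
  have hP : ∀ p ∈ P, p.Prime := fun p hp => (Nat.mem_primesBelow.1 hp).2
  have hlz : 0 < Real.log z := Real.log_pos hz
  have hpos : ∀ p ∈ P, 0 < 1 - 1 / (p : ℝ) := fun p hp => by
    have : (1 : ℝ) < p := by exact_mod_cast (hP p hp).one_lt
    rw [sub_pos, div_lt_one (by linarith)]; exact this
  have h1 := prod_localFactor_le hk hmul h (P := P \ E) fun p hp => hP p (mem_sdiff.1 hp).1
  rw [Finset.prod_div_distrib, Finset.prod_pow] at h1
  have hpos' : 0 < ∏ p ∈ P \ E, (1 - 1 / (p : ℝ)) :=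
    Finset.prod_pos fun p hp => hpos p (mem_sdiff.1 hp).1
  rw [div_le_iff₀ (pow_pos hpos' k)] at h1
  refine h1.trans ?_
  have hS : 0 ≤ partialProductBound k * singularSeries a b :=
    zero_le_one.trans (one_le_mul_singularSeries hk hmul h)
  have h2 : ∏ p ∈ P, (1 - 1 / (p : ℝ)) ≤ (Real.log z)⁻¹ := by
    have h3 := log_le_prod_inv ⌊z⌋₊
    rw [Finset.prod_inv_distrib] at h3
    have h4 : Real.log z ≤ Real.log (⌊z⌋₊ + 1) :=
      Real.log_le_log (by linarith) (Nat.lt_floor_add_one z).le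
    exact le_inv_of_le_inv₀ hlz (h4.trans h3)
  -- The full product over `P` is at most `1 / log z`; restoring the discarded primes costs the
  -- product of inverses over `P ∩ E`.
  have h3 : ∏ p ∈ P \ E, (1 - 1 / (p : ℝ)) =
      (∏ p ∈ P, (1 - 1 / (p : ℝ))) * ∏ p ∈ P ∩ E, (1 - 1 / (p : ℝ))⁻¹ := by
    rw [← Finset.prod_inter_mul_prod_sdiff P E, Finset.prod_inv_distrib]
    have : ∏ p ∈ P ∩ E, (1 - 1 / (p : ℝ)) ≠ 0 :=
      (Finset.prod_pos fun p hp => hpos p (mem_inter.1 hp).1).ne'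
    field_simp
  have h4 := prod_inv_le_of_card (E := P ∩ E) (fun p hp => hP p (mem_inter.1 hp).1) hr
    ((Finset.card_le_card inter_subset_right).trans hE) hT
  have h5 : 0 ≤ ∏ p ∈ P ∩ E, (1 - 1 / (p : ℝ))⁻¹ :=
    Finset.prod_nonneg fun p hp => inv_nonneg.2 (hpos p (mem_inter.1 hp).1).le
  refine mul_le_mul_of_nonneg_left (pow_le_pow_left₀ hpos'.le ?_ k) hS
  rw [h3]
  exact mul_le_mul h2 h4 h5 (by positivity)

/-- The choice of `z` makes the Rankin level `Q = z ^ (4k + 1)` satisfy `Q ^ 4 = N`, as the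
separation argument requires. -/
lemma sieve_level {N : ℕ} (k : ℕ) :
    (((N : ℝ) ^ (1 / (4 * (4 * k + 1)) : ℝ)) ^ (4 * k + 1)) ^ 4 = N := by
  rw [← pow_mul, ← Real.rpow_natCast, ← Real.rpow_mul (Nat.cast_nonneg N)]
  have : (1 / (4 * (4 * k + 1)) : ℝ) * ((4 * k + 1) * 4 : ℕ) = 1 := by
    push_cast; field_simp
  rw [this, Real.rpow_one]

/-- The sieve bound for exponential sums over sifted sets, at several separated points. -/
theorem sum_norm_sq_expPoly_le_card {a b : Fin k → ℤ} (hk : 1 ≤ k)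
    (hmul : Multipliable (localFactor a b)) (h : NonDegenerate a b) {N : ℕ} (hN : 2 ≤ N)
    {T : ℕ} (hT : 1 < T) {s : Finset ℕ} (hsN : ∀ n ∈ s, n ≤ N)
    (hs : ∀ p : ℕ, p.Prime → (p : ℝ) ≤ (N : ℝ) ^ (1 / (4 * (4 * k + 1)) : ℝ) →
      ∀ n ∈ s, ¬ (p : ℤ) ∣ formProd a b n)
    {ι : Type*} [DecidableEq ι] {I : Finset ι} (hI : I.Nonempty) {θ : ι → ℝ}
    (hθ : ∀ i ∈ I, θ i ∈ Set.Icc (0 : ℝ) 1)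
    (hsep : ∀ i ∈ I, ∀ j ∈ I, i ≠ j → 1 / (N : ℝ) ≤ |θ i - θ j|) :
    ∑ i ∈ I, ‖expPoly s (fun _ => 1) (θ i)‖ ^ 2 ≤
      sieveConst k T * (singularSeries a b * N * (Real.log N ^ k)⁻¹) * #s *
        (#I : ℝ) ^ (8 * k / Real.log T) := by
  set z : ℝ := (N : ℝ) ^ (1 / (4 * (4 * k + 1)) : ℝ) with hz
  have hN1 : (1 : ℝ) < N := by exact_mod_cast hN
  have hN0 : (0 : ℝ) < N := by linarith
  have hz1 : 1 < z := Real.one_lt_rpow hN1 (by positivity)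
  have hlogz : Real.log z = Real.log N / (4 * (4 * k + 1)) := by
    rw [hz, Real.log_rpow hN0]; ring
  have hlogN : 0 < Real.log N := Real.log_pos hN1
  set P := Nat.primesBelow (⌊z⌋₊ + 1) with hPdef
  have hP : ∀ p ∈ P, p.Prime := fun p hp => (Nat.mem_primesBelow.1 hp).2
  have hPz : ∀ p ∈ P, (p : ℝ) ≤ z := fun p hp => by
    have := (Nat.mem_primesBelow.1 hp).1
    exact (Nat.le_floor_iff (by linarith)).1 (by omega)
  have hmod : ∀ p ∈ P, ∀ n ∈ s, n % p ∈ coprimeResidues a b p := by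
    intro p hp n hn
    refine mem_filter.2 ⟨mem_range.2 (Nat.mod_lt _ (hP p hp).pos), ?_⟩
    by_contra hg
    rw [gcd_ne_one_iff (hP p hp), dvd_formProd_iff a b (hP p hp)] at hg
    obtain ⟨j, hj⟩ := hg
    refine hs p (hP p hp) (hPz p hp) n hn ((dvd_formProd_iff a b (hP p hp) n).2 ⟨j, ?_⟩)
    have e : a j * (n : ℤ) + b j = (a j * ((n % p : ℕ) : ℤ) + b j) + p * (a j * (n / p : ℕ)) := by
      have : (n : ℤ) = p * (n / p : ℕ) + (n % p : ℕ) := by exact_mod_cast (Nat.div_add_mod n p).symm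
      nth_rewrite 1 [this]; ring
    rw [e]
    exact dvd_add hj (dvd_mul_right _ _)
  obtain ⟨E, _, hEcard, hE⟩ := exists_sieve_sum_mul_le I θ (by omega : 1 ≤ N)
    (one_le_pow₀ hz1.le : 1 ≤ z ^ (4 * k + 1)) (sieve_level k).le hθ hsep P hP
    (coprimeResidues a b) (fun p _ => Finset.filter_subset _ _)
    (fun p hp => coprimeResidues_nonempty h (hP p hp).one_le) s hsN hmod fun _ => 1
  have hPE : ∀ p ∈ P \ E, p.Prime := fun p hp => hP p (mem_sdiff.1 hp).1
  have hγ : ∀ p ∈ P \ E, 0 < gamma a b p := fun p hp => h p (hPE p hp).one_le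
  have hR := half_prod_inv_le hPE hz1 (fun p hp => hPz p (mem_sdiff.1 hp).1)
    (k := k) (g := gamma a b) hγ (fun p _ => gamma_le_one a b p)
    fun p hp => one_sub_gamma_le h (hPE p hp)
  have hJ : ∀ p : ℕ, (p : ℝ) / #(coprimeResidues a b p) - 1 = (gamma a b p)⁻¹ - 1 := fun p => by
    rw [gamma_eq, inv_div]
  simp_rw [hJ] at hE
  have hsum0 : 0 ≤ ∑ i ∈ I, ‖expPoly s (fun _ => 1) (θ i)‖ ^ 2 :=
    Finset.sum_nonneg fun _ _ => by positivity
  have h1 := (mul_le_mul_of_nonneg_right hR hsum0).trans hE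
  have hG : 0 < ∏ p ∈ P \ E, gamma a b p := Finset.prod_pos hγ
  have h2 : ∑ i ∈ I, ‖expPoly s (fun _ => 1) (θ i)‖ ^ 2 ≤
      96 * N * #s * ∏ p ∈ P \ E, gamma a b p := by
    rw [Finset.prod_inv_distrib] at h1
    simp only [norm_one, one_pow, Finset.sum_const, nsmul_eq_mul, mul_one] at h1
    have h3 : 1 / 2 * (∏ p ∈ P \ E, gamma a b p)⁻¹ *
        ∑ i ∈ I, ‖expPoly s (fun _ => 1) (θ i)‖ ^ 2 =
        (∑ i ∈ I, ‖expPoly s (fun _ => 1) (θ i)‖ ^ 2) / (2 * ∏ p ∈ P \ E, gamma a b p) := by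
      field_simp
    rw [h3, div_le_iff₀ (by positivity)] at h1
    linarith
  have hr : 1 ≤ #I := Finset.card_pos.2 hI
  have h4 := prod_gamma_sdiff_le hk hmul h hz1 hr hEcard hT
  have hexp : Real.exp (2 + 2 * T) ≤ 3 ^ (2 + 2 * T) := by
    calc Real.exp (2 + 2 * T) = Real.exp 1 ^ (2 + 2 * T) := by
          rw [← Real.exp_nat_mul]; push_cast; ring_nf
      _ ≤ 3 ^ (2 + 2 * T) := by
          gcongr
          linarith [Real.exp_one_lt_d9]
  have hI0 : (0 : ℝ) < #I := by exact_mod_cast hr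
  have h5 : ((Real.log z)⁻¹ * (Real.exp (2 + 2 * T) * (#I : ℝ) ^ (8 / Real.log T))) ^ k ≤
      (4 * (4 * k + 1)) ^ k * (Real.log N ^ k)⁻¹ * 3 ^ ((2 + 2 * T) * k) *
        (#I : ℝ) ^ (8 * k / Real.log T) := by
    have h6 : (#I : ℝ) ^ (8 * k / Real.log T) = ((#I : ℝ) ^ (8 / Real.log T)) ^ k := by
      rw [← Real.rpow_mul_natCast hI0.le]; congr 1; ring
    rw [hlogz, inv_div, h6, pow_mul, ← inv_pow, ← mul_pow, ← mul_pow, ← mul_pow, ← div_eq_mul_inv,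
      mul_assoc]
    gcongr
  have hS : 0 ≤ partialProductBound k * singularSeries a b :=
    zero_le_one.trans (one_le_mul_singularSeries hk hmul h)
  calc _ ≤ 96 * N * #s * ∏ p ∈ P \ E, gamma a b p := h2
    _ ≤ 96 * N * #s * (partialProductBound k * singularSeries a b *
          ((4 * (4 * k + 1)) ^ k * (Real.log N ^ k)⁻¹ * 3 ^ ((2 + 2 * T) * k) *
            (#I : ℝ) ^ (8 * k / Real.log T))) := by
        refine mul_le_mul_of_nonneg_left (h4.trans ?_) (by positivity)
        exact mul_le_mul_of_nonneg_left h5 hS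
    _ = _ := by
        simp only [sieveConst]; push_cast; ring

theorem sum_norm_sq_expPoly_le {a b : Fin k → ℤ} (hk : 1 ≤ k)
    (hmul : Multipliable (localFactor a b)) (h : NonDegenerate a b) {N : ℕ} (hN : 2 ≤ N)
    {T : ℕ} (hT : 1 < T) {s : Finset ℕ} (hsN : ∀ n ∈ s, n ≤ N)
    (hs : ∀ p : ℕ, p.Prime → (p : ℝ) ≤ (N : ℝ) ^ (1 / (4 * (4 * k + 1)) : ℝ) →
      ∀ n ∈ s, ¬ (p : ℤ) ∣ formProd a b n)
    {ι : Type*} [DecidableEq ι] {I : Finset ι} (hI : I.Nonempty) {θ : ι → ℝ}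
    (hθ : ∀ i ∈ I, θ i ∈ Set.Icc (0 : ℝ) 1)
    (hsep : ∀ i ∈ I, ∀ j ∈ I, i ≠ j → 1 / (N : ℝ) ≤ |θ i - θ j|) :
    ∑ i ∈ I, ‖expPoly s (fun _ => 1) (θ i)‖ ^ 2 ≤
      (sieveConst k T * (singularSeries a b * N * (Real.log N ^ k)⁻¹)) ^ 2 *
        (#I : ℝ) ^ (8 * k / Real.log T) := by
  set B := sieveConst k T * (singularSeries a b * N * (Real.log N ^ k)⁻¹) with hB
  have hB0 : 0 ≤ B := by
    have h1 := (singularSeries_pos hk hmul h).le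
    have h2 := Real.log_natCast_nonneg N
    positivity
  have hcard : (#s : ℝ) ≤ B := by
    -- At the single point 0 the polynomial equals `#s`, so the previous bound reads `#s ^ 2 ≤ B *
    -- #s`.
    have h1 := sum_norm_sq_expPoly_le_card hk hmul h hN hT hsN hs
      (Finset.singleton_nonempty ()) (θ := fun _ => 0) (by simp) (by simp)
    have h2 : expPoly s (fun _ => 1) 0 = #s := by simp [expPoly, ee_zero]
    rw [Finset.sum_singleton, h2, Finset.card_singleton, Nat.cast_one, Real.one_rpow, mul_one,
      Complex.norm_natCast, ← hB, sq] at h1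
    rcases (Nat.cast_nonneg (α := ℝ) #s).eq_or_lt with h0 | h0
    · rw [← h0]; exact hB0
    · exact le_of_mul_le_mul_right h1 h0
  refine (sum_norm_sq_expPoly_le_card hk hmul h hN hT hsN hs hI hθ hsep).trans ?_
  rw [sq]
  gcongr

/-! ### From `X(F)` to the sifted set -/

lemma cardFactors_finset_prod {ι : Type*} (J : Finset ι) {f : ι → ℕ} (hf : ∀ j ∈ J, f j ≠ 0) :
    ArithmeticFunction.cardFactors (∏ j ∈ J, f j) =
      ∑ j ∈ J, ArithmeticFunction.cardFactors (f j) := by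
  classical
  induction J using Finset.induction_on with
  | empty => simp
  | insert i J hi ih =>
    rw [Finset.prod_insert hi, Finset.sum_insert hi,
      ArithmeticFunction.cardFactors_mul (hf i (mem_insert_self _ _))
        (Finset.prod_ne_zero_iff.2 fun j hj => hf j (mem_insert_of_mem hj)),
      ih fun j hj => hf j (mem_insert_of_mem hj)]

/-- If `F(n)` is a product of `k` primes and no form takes a value of size at most `1`, then all
the forms take prime values. -/
lemma natAbs_prime_of_isProductOfPrimes {a b : Fin k → ℤ} {n : ℤ}
    (h : IsProductOfPrimes k (formProd a b n)) (h2 : ∀ j, 2 ≤ (a j * n + b j).natAbs) (j : Fin k) :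
    (a j * n + b j).natAbs.Prime := by
  obtain ⟨q, hq, he⟩ := h
  have h1 : ∏ j, (a j * n + b j).natAbs = ∏ i, q i := by
    have := congrArg Int.natAbs he
    rw [formProd] at this
    zify at this ⊢
    simpa [Finset.abs_prod] using this
  -- Count prime factors with multiplicity: the `k` forms share `k` of them and each has at least
  -- one, so each has exactly one.
  have h3 := congrArg ArithmeticFunction.cardFactors h1
  rw [cardFactors_finset_prod (f := fun j => (a j * n + b j).natAbs) _
      (fun j _ => by have := h2 j; omega),
    cardFactors_finset_prod _ (fun i _ => (hq i).ne_zero),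
    Finset.sum_congr rfl fun i _ => ArithmeticFunction.cardFactors_apply_prime (hq i)] at h3
  have hge : ∀ j ∈ (univ : Finset (Fin k)),
      1 ≤ ArithmeticFunction.cardFactors (a j * n + b j).natAbs := fun j _ => by
    by_contra! h0
    have h4 := h2 j
    have h5 : ArithmeticFunction.cardFactors (a j * n + b j).natAbs = 0 := by omega
    rcases ArithmeticFunction.cardFactors_eq_zero_iff_eq_zero_or_one.1 h5 with h6 | h6 <;> omega
  exact ArithmeticFunction.cardFactors_eq_one_iff_prime.1
    (((Finset.sum_eq_sum_iff_of_le hge).1 h3.symm) j (mem_univ j)).symm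

/-- If all forms exceeded `z` in absolute value they would all be prime up to sign, and the one
divisible by `p` would have absolute value `p ≤ z`. -/
lemma exists_natAbs_le_of_mem_X {a b : Fin k → ℤ} {n : ℕ} (hn : n ∈ X a b) {z : ℕ} (hz : 1 ≤ z)
    {p : ℕ} (hp : p.Prime) (hpz : p ≤ z) (hpn : (p : ℤ) ∣ formProd a b n) :
    ∃ j, (a j * n + b j).natAbs ≤ z := by
  by_contra! hlt
  obtain ⟨j, hj⟩ := (dvd_formProd_iff a b hp n).1 hpn
  have h1 := natAbs_prime_of_isProductOfPrimes hn.2 (fun j => by have := hlt j; omega) j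
  have h2 := (Nat.prime_dvd_prime_iff_eq hp h1).1 (Int.natCast_dvd.1 hj)
  have := hlt j
  omega

lemma card_natAbs_le {α β : ℤ} (hα : α ≠ 0) (s : Finset ℕ) (z : ℕ) :
    #(s.filter fun n : ℕ => (α * n + β).natAbs ≤ z) ≤ 2 * z + 1 := by
  have h1 : #(s.filter fun n : ℕ => (α * n + β).natAbs ≤ z) ≤ #(Icc (-(z : ℤ)) z) := by
    refine Finset.card_le_card_of_injOn (fun n : ℕ => α * n + β) ?_ ?_
    · intro n hn
      have := (mem_filter.1 hn).2
      simp only [coe_Icc, Set.mem_Icc]; omega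
    · intro m _ n _ e
      have : α * (m : ℤ) = α * n := by simpa using e
      exact_mod_cast mul_left_cancel₀ hα this
  rw [Int.card_Icc] at h1
  omega

open Classical in
/-- The elements of `X(F)` up to `N` at which `F` has no prime factor at most `z`. -/
noncomputable def siftedPart (a b : Fin k → ℤ) (N : ℕ) (z : ℝ) : Finset ℕ :=
  (Icc 1 N).filter fun n => n ∈ X a b ∧ ∀ p : ℕ, p.Prime → (p : ℝ) ≤ z → ¬ (p : ℤ) ∣ formProd a b n

lemma mem_siftedPart {a b : Fin k → ℤ} {N : ℕ} {z : ℝ} {n : ℕ} :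
    n ∈ siftedPart a b N z ↔ n ∈ Icc 1 N ∧ n ∈ X a b ∧
      ∀ p : ℕ, p.Prime → (p : ℝ) ≤ z → ¬ (p : ℤ) ∣ formProd a b n := by
  classical exact mem_filter

/-- At each discarded `n` some form has absolute value at most `⌊z⌋`. A form takes each value at
most once, so there are at most `k (2⌊z⌋ + 1) ≤ 3kz` such `n`. -/
lemma norm_expSum_le {a b : Fin k → ℤ} (ha : ∀ j, a j ≠ 0) (N : ℕ) {z : ℝ} (hz : 1 ≤ z) (θ : ℝ) :
    ‖expSum a b N θ‖ ≤ ‖expPoly (siftedPart a b N z) (fun _ => 1) θ‖ + 3 * k * z := by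
  classical
  set Y := (Icc 1 N).filter fun n => n ∈ X a b with hY
  have hsub : siftedPart a b N z ⊆ Y := by
    intro n hn
    obtain ⟨h1, h2, _⟩ := mem_siftedPart.1 hn
    exact mem_filter.2 ⟨h1, h2⟩
  have h1 : expSum a b N θ = ∑ n ∈ Y \ siftedPart a b N z, ee (n * θ) +
      expPoly (siftedPart a b N z) (fun _ => 1) θ := by
    rw [expPoly]
    simp_rw [one_mul]
    rw [Finset.sum_sdiff hsub, expSum, hY]
    refine Finset.sum_congr ?_ fun _ _ => rfl
    ext n; simp
  rw [h1, add_comm]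
  refine (norm_add_le _ _).trans (add_le_add_right ?_ _)
  have h2 : ‖∑ n ∈ Y \ siftedPart a b N z, ee (n * θ)‖ ≤ #(Y \ siftedPart a b N z) := by
    refine (norm_sum_le _ _).trans (le_of_eq ?_)
    simp [norm_ee]
  refine h2.trans ?_
  have hfl : 1 ≤ ⌊z⌋₊ := Nat.le_floor (by exact_mod_cast hz)
  have h3 : Y \ siftedPart a b N z ⊆ (univ : Finset (Fin k)).biUnion fun j =>
      (Icc 1 N).filter fun n : ℕ => (a j * n + b j).natAbs ≤ ⌊z⌋₊ := by
    intro n hn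
    obtain ⟨hnY, hns⟩ := mem_sdiff.1 hn
    obtain ⟨hnI, hnX⟩ := mem_filter.1 hnY
    have : ∃ p : ℕ, p.Prime ∧ (p : ℝ) ≤ z ∧ (p : ℤ) ∣ formProd a b n := by
      by_contra! hno
      exact hns (mem_siftedPart.2 ⟨hnI, hnX, hno⟩)
    obtain ⟨p, hp, hpz, hpn⟩ := this
    obtain ⟨j, hj⟩ := exists_natAbs_le_of_mem_X hnX hfl hp (Nat.le_floor hpz) hpn
    exact mem_biUnion.2 ⟨j, mem_univ _, mem_filter.2 ⟨hnI, hj⟩⟩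
  have h4 := (Finset.card_le_card h3).trans
    (Finset.card_biUnion_le_card_mul _ _ (2 * ⌊z⌋₊ + 1) fun j _ => card_natAbs_le (ha j) _ _)
  rw [Finset.card_univ, Fintype.card_fin] at h4
  have h5 : (#(Y \ siftedPart a b N z) : ℝ) ≤ k * (2 * ⌊z⌋₊ + 1) := by exact_mod_cast h4
  have h6 := Nat.floor_le (by linarith : 0 ≤ z)
  calc _ ≤ (k : ℝ) * (2 * ⌊z⌋₊ + 1) := h5
    _ ≤ k * (2 * z + z) := by gcongr
    _ = _ := by ring

/-! ### The discrete restriction estimate -/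

/-- The constant of the bound `sum_norm_sq_expSum_le`. -/
def discreteConst (k T : ℕ) : ℕ :=
  2 * sieveConst k T ^ 2 + 18 * k ^ 2 * (4 * k) ^ (2 * k) * partialProductBound k ^ 2

lemma log_pow_le {N : ℕ} (hk : 1 ≤ k) :
    Real.log N ^ (2 * k) ≤ (4 * k) ^ (2 * k) * (N : ℝ) ^ (1 / 2 : ℝ) := by
  have hk0 : (0 : ℝ) < k := by exact_mod_cast hk
  have h1 := Real.log_le_rpow_div (Nat.cast_nonneg N) (by positivity : 0 < 1 / (4 * (k : ℝ)))
  have h2 := pow_le_pow_left₀ (Real.log_natCast_nonneg N) h1 (2 * k)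
  refine h2.trans (le_of_eq ?_)
  rw [div_eq_mul_inv, mul_pow, one_div, inv_inv, ← Real.rpow_mul_natCast (Nat.cast_nonneg N), mul_comm]
  congr 2
  push_cast; field_simp; norm_num

/-- The discrete restriction estimate. -/
theorem sum_norm_sq_expSum_le {a b : Fin k → ℤ} (hk : 1 ≤ k) (ha : ∀ j, a j ≠ 0)
    (hmul : Multipliable (localFactor a b)) (h : NonDegenerate a b) {N : ℕ} (hN : 2 ≤ N)
    {T : ℕ} (hT : 1 < T) {ι : Type*} [DecidableEq ι] {I : Finset ι} (hI : I.Nonempty)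
    (hIN : #I ≤ N) {θ : ι → ℝ} (hθ : ∀ i ∈ I, θ i ∈ Set.Icc (0 : ℝ) 1)
    (hsep : ∀ i ∈ I, ∀ j ∈ I, i ≠ j → 1 / (N : ℝ) ≤ |θ i - θ j|) :
    ∑ i ∈ I, ‖expSum a b N (θ i)‖ ^ 2 ≤
      discreteConst k T * (singularSeries a b * N * (Real.log N ^ k)⁻¹) ^ 2 *
        (#I : ℝ) ^ (8 * k / Real.log T) := by
  set z : ℝ := (N : ℝ) ^ (1 / (4 * (4 * k + 1)) : ℝ) with hz
  set M : ℝ := singularSeries a b * N * (Real.log N ^ k)⁻¹ with hM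
  have hN1 : (1 : ℝ) < N := by exact_mod_cast hN
  have hN0 : (0 : ℝ) < N := by linarith
  have hk0 : (1 : ℝ) ≤ k := by exact_mod_cast hk
  have hz1 : 1 ≤ z := (Real.one_lt_rpow hN1 (by positivity)).le
  have hL : 0 < Real.log N := Real.log_pos hN1
  have hI1 : (1 : ℝ) ≤ #I := by exact_mod_cast Finset.card_pos.2 hI
  have hT1 : 0 < Real.log T := Real.log_pos (by exact_mod_cast hT)
  have hpow1 : 1 ≤ (#I : ℝ) ^ (8 * k / Real.log T) := Real.one_le_rpow hI1 (by positivity)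
  have h1 := sum_norm_sq_expPoly_le hk hmul h hN hT (s := siftedPart a b N z)
    (fun n hn => (mem_Icc.1 (mem_siftedPart.1 hn).1).2)
    (fun p hp hpz n hn => (mem_siftedPart.1 hn).2.2 p hp hpz) hI hθ hsep
  rw [← hM] at h1
  have hz2 : z ^ 2 ≤ (N : ℝ) ^ (1 / 2 : ℝ) := by
    rw [hz, ← Real.rpow_mul_natCast hN0.le]
    refine Real.rpow_le_rpow_of_exponent_le hN1.le ?_
    push_cast
    rw [div_mul_eq_mul_div, div_le_div_iff₀ (by positivity) (by norm_num)]
    linarith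
  have hMlow : (N : ℝ) ^ 2 ≤ (4 * k) ^ (2 * k) * (N : ℝ) ^ (1 / 2 : ℝ) *
      partialProductBound k ^ 2 * M ^ 2 := by
    have h2 := one_le_mul_singularSeries hk hmul h
    have h3 : (N : ℝ) ≤ Real.log N ^ k * (partialProductBound k * M) := by
      rw [hM]
      have : Real.log N ^ k * (partialProductBound k *
        (singularSeries a b * N * (Real.log N ^ k)⁻¹)) =
          (partialProductBound k * singularSeries a b) * N := by
        field_simp
      rw [this]
      exact le_mul_of_one_le_left hN0.le h2
    calc (N : ℝ) ^ 2 ≤ (Real.log N ^ k * (partialProductBound k * M)) ^ 2 := by gcongr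
      _ = Real.log N ^ (2 * k) * (partialProductBound k ^ 2 * M ^ 2) := by ring
      _ ≤ ((4 * k) ^ (2 * k) * (N : ℝ) ^ (1 / 2 : ℝ)) * (partialProductBound k ^ 2 * M ^ 2) := by
          gcongr
          exact log_pow_le hk
      _ = _ := by ring
  -- The total error is `O(N z²) = O(N ^ (3/2))`. Since the singular series is bounded below and
  -- `(log N) ^ (2k)` is `O(N ^ (1/2))`, `M ^ 2` is at least a constant times `N ^ (3/2)`.
  have herr : (#I : ℝ) * (3 * k * z) ^ 2 ≤
      9 * k ^ 2 * (4 * k) ^ (2 * k) * partialProductBound k ^ 2 * M ^ 2 := by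
    have hhalf : (0 : ℝ) < (N : ℝ) ^ (1 / 2 : ℝ) := Real.rpow_pos_of_pos hN0 _
    have hsq : (N : ℝ) ^ (1 / 2 : ℝ) * (N : ℝ) ^ (1 / 2 : ℝ) = N := by
      rw [← Real.rpow_add hN0]; norm_num
    have h2 : (N : ℝ) * (N : ℝ) ^ (1 / 2 : ℝ) ≤
        (4 * k) ^ (2 * k) * partialProductBound k ^ 2 * M ^ 2 := by
      refine le_of_mul_le_mul_right ?_ hhalf
      calc (N : ℝ) * (N : ℝ) ^ (1 / 2 : ℝ) * (N : ℝ) ^ (1 / 2 : ℝ) = N ^ 2 := by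
            rw [mul_assoc, hsq, sq]
        _ ≤ _ := hMlow.trans (le_of_eq (by ring))
    have hIN' : (#I : ℝ) ≤ N := by exact_mod_cast hIN
    calc (#I : ℝ) * (3 * k * z) ^ 2 = 9 * k ^ 2 * (#I * z ^ 2) := by ring
      _ ≤ 9 * k ^ 2 * (N * (N : ℝ) ^ (1 / 2 : ℝ)) := by gcongr
      _ ≤ 9 * k ^ 2 * ((4 * k) ^ (2 * k) * partialProductBound k ^ 2 * M ^ 2) := by gcongr
      _ = _ := by ring
  calc ∑ i ∈ I, ‖expSum a b N (θ i)‖ ^ 2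
      ≤ ∑ i ∈ I, (2 * ‖expPoly (siftedPart a b N z) (fun _ => 1) (θ i)‖ ^ 2 +
          2 * (3 * k * z) ^ 2) := by
        refine Finset.sum_le_sum fun i _ => ?_
        have h2 := pow_le_pow_left₀ (norm_nonneg _) (norm_expSum_le (b := b) ha N hz1 (θ i)) 2
        refine h2.trans ?_
        nlinarith [sq_nonneg (‖expPoly (siftedPart a b N z) (fun _ => 1) (θ i)‖ - 3 * k * z)]
    _ = 2 * ∑ i ∈ I, ‖expPoly (siftedPart a b N z) (fun _ => 1) (θ i)‖ ^ 2 +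
          2 * (#I * (3 * k * z) ^ 2) := by
        rw [Finset.sum_add_distrib, ← Finset.mul_sum, Finset.sum_const, nsmul_eq_mul]; ring
    _ ≤ 2 * ((sieveConst k T * M) ^ 2 * (#I : ℝ) ^ (8 * k / Real.log T)) +
          2 * (9 * k ^ 2 * (4 * k) ^ (2 * k) * partialProductBound k ^ 2 * M ^ 2) *
            (#I : ℝ) ^ (8 * k / Real.log T) := by
        refine add_le_add (by gcongr) ?_
        refine le_trans (by gcongr) (le_mul_of_one_le_right (by positivity) hpow1)
    _ = _ := by
        simp only [discreteConst]; push_cast; ring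

/-! ### From square sums to the `L^p` norm -/

lemma sum_rpow_neg_le {η : ℝ} (hη : 0 < η) (n : ℕ) :
    ∑ r ∈ Icc 1 n, (r : ℝ) ^ (-(1 + η)) ≤ 1 + 1 / η := by
  rcases Nat.eq_zero_or_pos n with rfl | hn
  · simp; positivity
  -- The subtracted term, the tail of the comparison integral, is what makes the induction close.
  suffices H : ∑ r ∈ Icc 1 n, (r : ℝ) ^ (-(1 + η)) ≤ 1 + 1 / η - 1 / η * (n : ℝ) ^ (-η) by
    have : 0 ≤ 1 / η * (n : ℝ) ^ (-η) := by positivity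
    linarith
  induction n, hn using Nat.le_induction with
  | base => simp
  | succ n hn ih =>
    rw [Finset.sum_Icc_succ_top (by omega)]
    have hn0 : (0 : ℝ) < n := by exact_mod_cast hn
    have hn1 : (0 : ℝ) < ((n + 1 : ℕ) : ℝ) := by positivity
    set y : ℝ := ((n + 1 : ℕ) : ℝ) with hy
    have h1 : y ^ (-(1 + η)) = y ^ (-η) * (1 / y) := by
      rw [neg_add, Real.rpow_add hn1, Real.rpow_neg_one, mul_comm, one_div]
    have h2 : y ^ (-η) * (1 + η / y) ≤ (n : ℝ) ^ (-η) := by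
      have h3 : (n : ℝ) = y * (1 - 1 / y) := by rw [hy]; push_cast; field_simp; ring
      have h4 : 0 < 1 - 1 / y := by
        have : 0 < y * (1 - 1 / y) := h3 ▸ hn0
        exact pos_of_mul_pos_right this hn1.le
      rw [h3, Real.mul_rpow hn1.le h4.le]
      refine mul_le_mul_of_nonneg_left ?_ (Real.rpow_nonneg hn1.le _)
      rw [Real.rpow_def_of_pos h4]
      have h5 := Real.log_le_sub_one_of_pos h4
      have h6 := Real.add_one_le_exp (Real.log (1 - 1 / y) * -η)
      have h7 : η / y = η * (1 / y) := by ring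
      nlinarith
    have h8 : 1 / η * (y ^ (-η) * (1 + η / y)) = 1 / η * y ^ (-η) + y ^ (-η) * (1 / y) := by
      field_simp
    have h9 := mul_le_mul_of_nonneg_left h2 (by positivity : 0 ≤ 1 / η)
    rw [h1]
    linarith

/-- Square sum bounds over all subsets give bounds for higher moments. -/
lemma sum_rpow_le_of_sum_sq_le {ι : Type*} [DecidableEq ι] {v : ι → ℝ} (hv : ∀ i, 0 ≤ v i)
    {B ε p : ℝ} (hB : 0 ≤ B) (hp : 0 < p) (J : Finset ι)
    (h : ∀ I ⊆ J, I.Nonempty → ∑ i ∈ I, v i ^ 2 ≤ B * (#I : ℝ) ^ ε) :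
    ∑ i ∈ J, v i ^ p ≤ B ^ (p / 2) * ∑ r ∈ Icc 1 #J, (r : ℝ) ^ (-((1 - ε) * (p / 2))) := by
  induction J using Finset.induction_on_min_value v with
  | empty => simp
  | insert i J hi hmin ih =>
    have ih' := ih fun I hI => h I (hI.trans (subset_insert _ _))
    rw [Finset.sum_insert hi, Finset.card_insert_of_notMem hi, Finset.sum_Icc_succ_top (by omega),
      mul_add, add_comm]
    refine add_le_add ih' ?_
    have h1 := h (insert i J) subset_rfl (insert_nonempty _ _)
    rw [Finset.card_insert_of_notMem hi] at h1
    -- The induction inserts elements in decreasing order of value: `v i` is the minimum, so its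
    -- square is at most the average of the squares.
    have h2 : ((#J + 1 : ℕ) : ℝ) * v i ^ 2 ≤ ∑ l ∈ insert i J, v l ^ 2 := by
      rw [← Finset.card_insert_of_notMem hi, ← nsmul_eq_mul]
      refine Finset.card_nsmul_le_sum _ _ _ fun l hl => ?_
      rcases mem_insert.1 hl with rfl | hl
      · exact le_rfl
      · exact pow_le_pow_left₀ (hv i) (hmin l hl) 2
    set y : ℝ := ((#J + 1 : ℕ) : ℝ) with hy
    have hy0 : 0 < y := by rw [hy]; positivity
    have h3 : v i ^ 2 ≤ B * y ^ (-(1 - ε)) := by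
      have h4 : y ^ (-(1 - ε)) = y ^ ε / y := by
        rw [neg_sub, Real.rpow_sub_one hy0.ne']
      rw [h4, ← mul_div_assoc, le_div_iff₀ hy0, mul_comm]
      exact h2.trans h1
    calc v i ^ p = (v i ^ 2) ^ (p / 2) := by
          rw [← Real.rpow_natCast, ← Real.rpow_mul (hv i)]; congr 1; push_cast; ring
      _ ≤ (B * y ^ (-(1 - ε))) ^ (p / 2) := by
          gcongr
      _ = B ^ (p / 2) * y ^ (-((1 - ε) * (p / 2))) := by
          rw [Real.mul_rpow hB (by positivity), ← Real.rpow_mul hy0.le]; congr 2; ring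

/-- Cutting `[0, 1]` into `N` intervals of length `1/N` and translating them all to `[0, 1/N]` turns
the integral into one of the shifted sum. -/
lemma integral_le_of_sum_shift_le {f : ℝ → ℝ} (hf : Continuous f) {N : ℕ} (hN : 1 ≤ N) {K : ℝ}
    (h : ∀ t ∈ Set.Icc (0 : ℝ) (1 / N), ∑ j ∈ range N, f (t + j / N) ≤ K) :
    ∫ θ in (0 : ℝ)..1, f θ ≤ K / N := by
  have hN0 : (0 : ℝ) < N := by exact_mod_cast hN
  have h1 := intervalIntegral.sum_integral_adjacent_intervals (f := f) (a := fun j : ℕ => (j : ℝ) / N)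
    (n := N) (μ := MeasureTheory.volume) fun j _ => hf.intervalIntegrable _ _
  have h2 : ∀ j : ℕ, ∫ x in ((j : ℝ) / N)..(((j + 1 : ℕ) : ℝ) / N), f x =
      ∫ t in (0 : ℝ)..(1 / N), f (t + j / N) := by
    intro j
    rw [intervalIntegral.integral_comp_add_right]
    congr 1
    · ring
    · push_cast; ring
  simp only [h2, Nat.cast_zero, zero_div, div_self hN0.ne'] at h1
  rw [← h1, ← intervalIntegral.integral_finsetSum
    fun j _ => Continuous.intervalIntegrable (by fun_prop) _ _]
  have h3 : ∫ t in (0 : ℝ)..(1 / N), ∑ j ∈ range N, f (t + j / N) ≤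
      ∫ _t in (0 : ℝ)..(1 / N), K :=
    intervalIntegral.integral_mono_on (by positivity)
      (Continuous.intervalIntegrable (by fun_prop) _ _) (by simp) h
  refine h3.trans (le_of_eq ?_)
  rw [intervalIntegral.integral_const, smul_eq_mul, sub_zero]; ring

lemma continuous_expSum (a b : Fin k → ℤ) (N : ℕ) : Continuous (expSum a b N) := by
  unfold expSum; fun_prop

/-- The constant of the restriction estimate when `p > 2 + 1 / m`. -/
def restrictionConst (m k : ℕ) : ℕ := discreteConst k (3 ^ (64 * k * m)) * (4 * m + 1)

theorem circleLpNorm_expSum_le {a b : Fin k → ℤ} (hk : 1 ≤ k) (ha : ∀ j, a j ≠ 0)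
    (hmul : Multipliable (localFactor a b)) (h : NonDegenerate a b) {N : ℕ} (hN : 2 ≤ N)
    {m : ℕ} (hm : 1 ≤ m) {p : ℝ} (hp : 2 + 1 / (m : ℝ) ≤ p) :
    circleLpNorm (expSum a b N) p ≤
      restrictionConst m k * singularSeries a b * (N : ℝ) ^ (1 - 1 / p) * (Real.log N ^ k)⁻¹ := by
  set T : ℕ := 3 ^ (64 * k * m) with hT
  have hm0 : (1 : ℝ) ≤ m := by exact_mod_cast hm
  have hk0 : (1 : ℝ) ≤ k := by exact_mod_cast hk
  have hN0 : (0 : ℝ) < N := by positivity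
  have hminv : 0 < 1 / (m : ℝ) := by positivity
  have hp2 : 2 < p := by linarith
  have hT1 : 1 < T := Nat.one_lt_pow (by positivity) (by norm_num)
  have hlogT : 64 * (k : ℝ) * m ≤ Real.log T := by
    rw [hT]; push_cast; rw [Real.log_pow]; push_cast
    refine le_mul_of_one_le_right (by positivity) ?_
    rw [Real.le_log_iff_exp_le (by norm_num)]
    linarith [Real.exp_one_lt_d9]
  -- With this `ε` and `p ≥ 2 + 1/m`, the exponent `(1 - ε) p / 2` is at least `1 + 1/(4m)`, so the
  -- series over `r` is at most `4m + 1`. The base `T` is chosen so that `8k / log T ≤ ε`.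
  set ε : ℝ := 1 / (8 * m) with hε
  have hεT : 8 * k / Real.log T ≤ ε := by
    rw [hε, div_le_div_iff₀ (lt_of_lt_of_le (by positivity) hlogT) (by positivity)]
    linarith
  set M : ℝ := singularSeries a b * N * (Real.log N ^ k)⁻¹ with hM
  have hL : 0 < Real.log N := Real.log_pos (by exact_mod_cast hN)
  have hS := singularSeries_pos hk hmul h
  have hM0 : 0 < M := by positivity
  set B : ℝ := discreteConst k T * M ^ 2 with hB
  have hB0 : 0 ≤ B := by positivity
  have hexpo : 1 + 1 / (4 * (m : ℝ)) ≤ (1 - ε) * (p / 2) := by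
    have hε1 : ε = 1 / m / 8 := by rw [hε]; field_simp
    have h4 : 1 / (4 * (m : ℝ)) = 1 / m / 4 := by field_simp
    have hminv1 : 1 / (m : ℝ) ≤ 1 := by rw [div_le_one (by linarith)]; exact hm0
    rw [hε1, h4]
    nlinarith
  have hsum : ∀ t ∈ Set.Icc (0 : ℝ) (1 / N),
      ∑ j ∈ range N, ‖expSum a b N (t + j / N)‖ ^ p ≤ B ^ (p / 2) * (4 * m + 1) := by
    intro t ht
    have h1 : ∀ I ⊆ range N, I.Nonempty →
        ∑ j ∈ I, ‖expSum a b N (t + j / N)‖ ^ 2 ≤ B * (#I : ℝ) ^ ε := by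
      intro I hI hne
      have hIcard : #I ≤ N := by simpa using Finset.card_le_card hI
      have h2 := sum_norm_sq_expSum_le hk ha hmul h hN hT1 hne hIcard
        (θ := fun j : ℕ => t + j / N) ?_ ?_
      · refine h2.trans ?_
        rw [← hM, ← hB]
        have : (1 : ℝ) ≤ #I := by exact_mod_cast Finset.card_pos.2 hne
        gcongr
      · intro j hj
        have hjN : j + 1 ≤ N := mem_range.1 (hI hj)
        have h3 : ((j : ℝ) + 1) / N ≤ 1 := by
          rw [div_le_one hN0]; exact_mod_cast hjN
        rw [add_div] at h3
        have h4 : (0 : ℝ) ≤ j / N := by positivity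
        exact ⟨by linarith [ht.1], by linarith [ht.2]⟩
      · intro i _ j _ hij
        rw [add_sub_add_left_eq_sub, ← sub_div, abs_div, abs_of_pos hN0]
        gcongr
        have : (1 : ℤ) ≤ |(i : ℤ) - j| := Int.one_le_abs (by omega)
        exact_mod_cast this
    have h2 := sum_rpow_le_of_sum_sq_le (v := fun j : ℕ => ‖expSum a b N (t + j / N)‖)
      (fun _ => norm_nonneg _) hB0 (by linarith : 0 < p) (range N) h1
    refine h2.trans (mul_le_mul_of_nonneg_left ?_ (by positivity))
    have h3 := sum_rpow_neg_le (η := 1 / (4 * (m : ℝ))) (by positivity) #(range N)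
    have h4 : 1 + 1 / (1 / (4 * (m : ℝ))) = 4 * m + 1 := by rw [one_div_one_div]; ring
    rw [h4] at h3
    refine le_trans (Finset.sum_le_sum fun r hr => ?_) h3
    have : (1 : ℝ) ≤ r := by exact_mod_cast (mem_Icc.1 hr).1
    exact Real.rpow_le_rpow_of_exponent_le this (by linarith)
  have hcont : Continuous fun θ => ‖expSum a b N θ‖ ^ p :=
    (continuous_expSum a b N).norm.rpow_const fun _ => Or.inr (by linarith)
  have hint := integral_le_of_sum_shift_le hcont (by omega : 1 ≤ N) hsum
  have hint0 : 0 ≤ ∫ θ in (0 : ℝ)..1, ‖expSum a b N θ‖ ^ p :=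
    intervalIntegral.integral_nonneg zero_le_one fun _ _ => by positivity
  have hp0 : 0 < 1 / p := by positivity
  have hp1 : 1 / p ≤ 1 := by rw [div_le_one (by linarith)]; linarith
  have hD1 : (1 : ℝ) ≤ discreteConst k T := by
    have : 0 < partialProductBound k := by exact_mod_cast partialProductBound_pos hk
    have h2 : 0 < discreteConst k T := by unfold discreteConst; positivity
    exact_mod_cast h2
  rw [circleLpNorm]
  calc (∫ θ in (0 : ℝ)..1, ‖expSum a b N θ‖ ^ p) ^ (1 / p)
      ≤ (B ^ (p / 2) * (4 * m + 1) / N) ^ (1 / p) := by gcongr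
    _ = B ^ (1 / 2 : ℝ) * (4 * m + 1 : ℝ) ^ (1 / p) / (N : ℝ) ^ (1 / p) := by
        rw [Real.div_rpow (by positivity) hN0.le, Real.mul_rpow (by positivity) (by positivity),
          ← Real.rpow_mul hB0]
        congr 3
        field_simp
    _ ≤ (discreteConst k T * M) * (4 * m + 1) / (N : ℝ) ^ (1 / p) := by
        have h1 : B ^ (1 / 2 : ℝ) ≤ discreteConst k T * M := by
          rw [← Real.sqrt_eq_rpow]
          refine Real.sqrt_le_iff.2 ⟨by positivity, ?_⟩
          rw [hB, mul_pow (discreteConst k T : ℝ) M 2]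
          exact mul_le_mul_of_nonneg_right (le_self_pow₀ hD1 two_ne_zero) (sq_nonneg M)
        have h2 : (4 * m + 1 : ℝ) ^ (1 / p) ≤ 4 * m + 1 := by
          conv_rhs => rw [← Real.rpow_one (4 * m + 1 : ℝ)]
          exact Real.rpow_le_rpow_of_exponent_le (by linarith) hp1
        gcongr
    _ = _ := by
        rw [hM, Real.rpow_sub hN0, Real.rpow_one, restrictionConst, ← hT]
        push_cast
        ring

/-! ### Computability of the constant -/

lemma primrec₂_pow : Primrec₂ ((· ^ ·) : ℕ → ℕ → ℕ) :=
  Primrec₂.unpaired'.1 Nat.Primrec.pow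

lemma primrec₂_restrictionConst : Primrec₂ restrictionConst := by
  have hadd {f g : ℕ × ℕ → ℕ} (hf : Primrec f) (hg : Primrec g) : Primrec fun x => f x + g x :=
    Primrec.nat_add.comp hf hg
  have hmul {f g : ℕ × ℕ → ℕ} (hf : Primrec f) (hg : Primrec g) : Primrec fun x => f x * g x :=
    Primrec.nat_mul.comp hf hg
  have hpow {f g : ℕ × ℕ → ℕ} (hf : Primrec f) (hg : Primrec g) : Primrec fun x => f x ^ g x :=
    primrec₂_pow.comp hf hg
  have hm : Primrec fun x : ℕ × ℕ => x.1 := Primrec.fst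
  have hk : Primrec fun x : ℕ × ℕ => x.2 := Primrec.snd
  have hc (n : ℕ) : Primrec fun _ : ℕ × ℕ => n := Primrec.const n
  have hT : Primrec fun x : ℕ × ℕ => 3 ^ (64 * x.2 * x.1) :=
    hpow (hc 3) (hmul (hmul (hc 64) hk) hm)
  have hP : Primrec fun x : ℕ × ℕ => partialProductBound x.2 :=
    hmul (hpow (hmul (hc 2) hk) (hmul (hc 2) hk)) (hpow (hc 3) (hmul (hc 2) (hpow hk (hc 2))))
  have hS : Primrec fun x : ℕ × ℕ => sieveConst x.2 (3 ^ (64 * x.2 * x.1)) :=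
    hmul (hmul (hmul (hc 96) hP) (hpow (hmul (hc 4) (hadd (hmul (hc 4) hk) (hc 1))) hk))
      (hpow (hc 3) (hmul (hadd (hc 2) (hmul (hc 2) hT)) hk))
  have hD : Primrec fun x : ℕ × ℕ => discreteConst x.2 (3 ^ (64 * x.2 * x.1)) :=
    hadd (hmul (hc 2) (hpow hS (hc 2)))
      (hmul (hmul (hmul (hc 18) (hpow hk (hc 2))) (hpow (hmul (hc 4) hk) (hmul (hc 2) hk)))
        (hpow hP (hc 2)))
  exact hmul hD (hadd (hmul (hc 4) hm) (hc 1))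

/-- Turns the real floor in the constant into natural-number arithmetic. Computability concerns all
inputs, so the degenerate cases matter: for `s = 0` or `r ≤ 2s` both sides are 0. -/
lemma floor_one_div_div_sub_two (r s : ℕ) : ⌊1 / ((r : ℝ) / s - 2)⌋₊ = s / (r - 2 * s) := by
  rcases Nat.eq_zero_or_pos s with rfl | hs
  · rw [Nat.zero_div, Nat.floor_eq_zero]; norm_num
  have hs0 : (0 : ℝ) < s := by exact_mod_cast hs
  rcases le_or_gt r (2 * s) with h | h
  · rw [Nat.sub_eq_zero_of_le h, Nat.div_zero, Nat.floor_of_nonpos]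
    refine one_div_nonpos.2 (sub_nonpos.2 ?_)
    rw [div_le_iff₀ hs0]; exact_mod_cast h
  · rw [← Nat.floor_div_eq_div (K := ℝ)]
    congr 1
    rw [Nat.cast_sub h.le]
    have : (r : ℝ) - 2 * s ≠ 0 := by
      have : (2 * s : ℝ) < r := by exact_mod_cast h
      linarith
    push_cast
    field_simp

end PrimeTuples

theorem theorem1 :
    ∃ C : ℝ → ℕ → ℕ,
      Computable (fun x : ℕ × ℕ × ℕ => C ((x.1 : ℝ) / (x.2.1 : ℝ)) x.2.2) ∧
      ∀ (k : ℕ), 1 ≤ k → ∀ (p : ℝ), 2 < p →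
      ∀ (N : ℕ), 2 ≤ N → ∀ (a b : Fin k → ℤ),
        (∀ j, a j ≠ 0) →
        PrimeTuples.discriminant a b ≠ 0 →
        PrimeTuples.NonDegenerate a b →
        (∀ j, |a j| ≤ (N : ℤ) ∧ |b j| ≤ (N : ℤ)) →
        Multipliable (PrimeTuples.localFactor a b) ∧
        PrimeTuples.circleLpNorm (PrimeTuples.expSum a b N) p ≤
          (C p k : ℝ) * PrimeTuples.singularSeries a b *
            (N : ℝ) ^ (1 - 1 / p) * ((Real.log (N : ℝ)) ^ k)⁻¹ := by
  -- Here `m = ⌊1/(p - 2)⌋ + 1` is a positive integer with `1/m ≤ p - 2`.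
  refine ⟨fun p k => PrimeTuples.restrictionConst (⌊1 / (p - 2)⌋₊ + 1) k, ?_, ?_⟩
  · simp only [PrimeTuples.floor_one_div_div_sub_two]
    have hr : Primrec fun x : ℕ × ℕ × ℕ => x.1 := Primrec.fst
    have hs : Primrec fun x : ℕ × ℕ × ℕ => x.2.1 := Primrec.fst.comp Primrec.snd
    have hk : Primrec fun x : ℕ × ℕ × ℕ => x.2.2 := Primrec.snd.comp Primrec.snd
    have hm : Primrec fun x : ℕ × ℕ × ℕ => x.2.1 / (x.1 - 2 * x.2.1) + 1 :=
      Primrec.nat_add.comp (Primrec.nat_div.comp hs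
        (Primrec.nat_sub.comp hr (Primrec.nat_mul.comp (Primrec.const 2) hs))) (Primrec.const 1)
    exact (PrimeTuples.primrec₂_restrictionConst.comp hm hk).to_comp
  · intro k hk p hp N hN a b ha hd h _
    have hmul := PrimeTuples.multipliable_localFactor ha hd h
    refine ⟨hmul, PrimeTuples.circleLpNorm_expSum_le hk ha hmul h hN (Nat.le_add_left 1 _) ?_⟩
    have hlt := Nat.lt_floor_add_one (1 / (p - 2))
    have hp0 : 0 < p - 2 := by linarith
    rw [div_lt_iff₀ hp0] at hlt
    have hm0 : (0 : ℝ) < ⌊1 / (p - 2)⌋₊ + 1 := by positivity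
    have : 1 / ((⌊1 / (p - 2)⌋₊ : ℝ) + 1) ≤ p - 2 := by
      rw [div_le_iff₀ hm0]; linarith
    push_cast
    linarith
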